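/- A continuum is a compact connected metric space with more than one point. A tree is a continuum $X$ that contains no simple closed curve (no subset homeomorphic to the circle) and is the union of finitely many arcs (subsets homeomorphic to $[0,1]$), any two of which meet at most in one or both of their end points. The order of a point $p\in X$ is the least cardinal $\kappa$ such that $p$ has arbitrarily small open neighborhoods whose boundary has cardinality at most $\kappa$; let $E(X)$ be the set of points of order $1$ (endpoints) and $R(X)$ the set of points of order at least $3$ (ramification points). Let $NC^*(X)$ be the set of nonempty closed connected sets $A\subseteq X$ such that $X\setminus A$ is connected (the empty set counts as connected, so $X\in NC^*(X)$), with the Vietoris topology, equivalently the topology of the Hausdorff metric. For $n\ge 3$, a simple $n$-od is a space homeomorphic to the cone over the discrete space with $n$ points. Theorem. Let $X$ be a tree that is not homeomorphic to $[0,1]$. Then $R(X)$ and $E(X)$ are finite and, with $m=|R(X)|$ and $n=|E(X)|$, we have $n\ge 3$ and $$NC^*(X)\;\approx\;\mathcal K\oplus\Bigl(\bigoplus_{i=1}^{n+2m-2}[0,1)\Bigr),$$ where $\mathcal K$ is a simple $n$-od, $\oplus$ denotes the disjoint topological sum and $\approx$ means homeomorphic. -/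

import Mathlib

open TopologicalSpace Set

/-- `A` is an arc in `X` (a subset homeomorphic to `[0,1]`) whose end points are `a` and `b`. -/
def IsArcWithEnds {X : Type*} [TopologicalSpace X] (A : Set X) (a b : X) : Prop :=
  ∃ h : unitInterval ≃ₜ A, (h 0 : X) = a ∧ (h 1 : X) = b

/-- `S` is a simple closed curve in `X`: a subset homeomorphic to the unit circle. -/
def IsSimpleClosedCurve {X : Type*} [TopologicalSpace X] (S : Set X) : Prop :=
  Nonempty (S ≃ₜ Circle)

/-- A continuum: a compact connected metric space with more than one point. -/
structure IsContinuum (X : Type*) [MetricSpace X] : Prop where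
  compact : CompactSpace X
  connected : ConnectedSpace X
  nontrivial : Nontrivial X

/-- A finite graph: a continuum that is the union of finitely many arcs, any two of which
intersect at most in one or both of their end points. -/
structure IsFiniteGraph (X : Type*) [MetricSpace X] : Prop where
  isContinuum : IsContinuum X
  exists_arcs : ∃ (k : ℕ) (A : Fin k → Set X) (a b : Fin k → X),
    (∀ i, IsArcWithEnds (A i) (a i) (b i)) ∧
    (⋃ i, A i) = univ ∧
    ∀ i j, i ≠ j → A i ∩ A j ⊆ {a i, b i} ∩ {a j, b j}

/-- A tree: a finite graph that contains no simple closed curve. -/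
structure IsTopologicalTree (X : Type*) [MetricSpace X] : Prop where
  isFiniteGraph : IsFiniteGraph X
  no_simpleClosedCurve : ∀ S : Set X, ¬ IsSimpleClosedCurve S

/-- The Menger–Urysohn order of `p` in `X`: the least cardinal `κ` such that `p` has arbitrarily
small open neighbourhoods with boundary of cardinality at most `κ`. -/
noncomputable def mengerOrder {X : Type*} [TopologicalSpace X] (p : X) : Cardinal :=
  sInf {κ : Cardinal | ∀ U : Set X, IsOpen U → p ∈ U →
    ∃ V : Set X, IsOpen V ∧ p ∈ V ∧ V ⊆ U ∧ Cardinal.mk (frontier V) ≤ κ}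

/-- The set `E(X)` of end points: the points of order `1`. -/
def endpointSet (X : Type*) [TopologicalSpace X] : Set X :=
  {p | mengerOrder p = 1}

/-- The set `R(X)` of ramification points: the points of order at least `3`. -/
def ramificationSet (X : Type*) [TopologicalSpace X] : Set X :=
  {p | 3 ≤ mengerOrder p}

/-- The hyperspace `NC*(X)` of the nonempty compact connected subsets of `X` whose complement is
connected (the empty set counts as connected, so that `X` itself belongs to `NC*(X)` when `X` is
a continuum). It carries the subspace topology of the Vietoris topology on `NonemptyCompacts X`,
which for metric `X` is the topology of the Hausdorff metric. -/
def NCStar (X : Type*) [TopologicalSpace X] : Set (NonemptyCompacts X) :=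
  {A | IsConnected (A : Set X) ∧ IsPreconnected (A : Set X)ᶜ}

/-- The equivalence relation on `Y × [0,1]` that identifies all points of `Y × {1}`. -/
def coneSetoid (Y : Type*) : Setoid (Y × unitInterval) where
  r p q := p = q ∨ (p.2 = 1 ∧ q.2 = 1)
  iseqv :=
    { refl := fun _ => Or.inl rfl
      symm := by
        rintro p q (h | ⟨h₁, h₂⟩)
        · exact Or.inl h.symm
        · exact Or.inr ⟨h₂, h₁⟩
      trans := by
        rintro p q r (rfl | ⟨h₁, h₂⟩) (rfl | ⟨h₃, h₄⟩)
        · exact Or.inl rfl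
        · exact Or.inr ⟨h₃, h₄⟩
        · exact Or.inr ⟨h₁, h₂⟩
        · exact Or.inr ⟨h₁, h₄⟩ }

/-- The cone over `Y`, with the quotient topology. -/
abbrev TopologicalCone (Y : Type*) : Type _ := Quotient (coneSetoid Y)

/-- A simple `n`-od, for `n ≥ 3`: a space homeomorphic to the cone over the discrete space with
`n` points. -/
def IsSimpleNOd (n : ℕ) (Z : Type*) [TopologicalSpace Z] : Prop :=
  3 ≤ n ∧ Nonempty (Z ≃ₜ TopologicalCone (Fin n))

/-! Cover `X` by as few arcs as possible and regard them as the edges of a graph on their end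
points. The absence of simple closed curves makes this graph simple and acyclic, the connectedness
of `X` makes it a tree, and minimality excludes vertices of degree 2, at which two arcs could be
merged (`ArcFamily.nonempty_merge`). The order of a point is the number of directions leaving it
(`mengerOrder_eq`), so endpoints and ramification points are the vertices of degree 1 and of degree
at least 3.

Removing a point from a tree leaves one branch for each direction. If `A` is a proper member of
`NCStar X` and `p` a boundary point of it, the connected complement lies in a single branch at `p`,
and `A` turns out to be everything outside that branch (`exists_eq_back`). So `A = back d t` for a
unique directed edge `d` and a unique `t < 1` (`back_injective`), and all these sets do belong to
`NCStar X`. For fixed `d` they form a path in the hyperspace. At `t = 1` it reaches `X` if `d`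
points to a leaf; if `d` points to a ramification vertex, it reaches a set with disconnected
complement and so leaves `NCStar X`. The paths of the first kind form a cone with apex `X`, those of
the second kind are half-open intervals closed in `NCStar X`, and finitely many such pieces assemble
to a homeomorphism (`nonempty_homeomorph_cone_sum_Ico`).

With `n` leaves and `m` ramification vertices there are `2(n + m - 1)` directed edges, `n` of which
point to leaves, and `n + 2m - 2` remain. The degree sum gives `n ≥ m + 2`, and `m ≥ 1` since
otherwise `X` is a single arc. -/

open scoped unitInterval

/-- A presentation of a space `X` as a geometric realization of the simple graph `G`: every dart of
`G` is realized by an arc, and the arcs of distinct edges meet only in vertices. -/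
structure ArcRealization {V : Type*} (G : SimpleGraph V) (X : Type*) [TopologicalSpace X] where
  pt : V → X
  arc : G.Dart → I → X
  pt_injective : Function.Injective pt
  continuous_arc : ∀ d, Continuous (arc d)
  arc_injective : ∀ d, Function.Injective (arc d)
  arc_zero : ∀ d, arc d 0 = pt d.fst
  arc_symm : ∀ d t, arc d.symm t = arc d (σ t)
  exists_arc_eq : ∀ x, ∃ d t, arc d t = x
  pt_ne_arc : ∀ v d t, t ≠ 0 → t ≠ 1 → pt v ≠ arc d t
  eq_or_eq_symm : ∀ d e s t, s ≠ 0 → s ≠ 1 → arc d s = arc e t → e = d ∨ e = d.symm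

/-! ### The two sides of an edge of a tree. -/

namespace SimpleGraph

variable {V : Type*} {G : SimpleGraph V}

/-- The vertices that can be reached from the source of `d` without using the edge of `d`. -/
def Dart.Behind (d : G.Dart) (w : V) : Prop :=
  (G.deleteEdges {d.edge}).Reachable d.fst w

theorem Dart.behind_fst (d : G.Dart) : d.Behind d.fst := SimpleGraph.Reachable.refl _

theorem Dart.Behind.snd {d e : G.Dart} (h : d.Behind e.fst) (h₁ : e ≠ d) (h₂ : e ≠ d.symm) :
    d.Behind e.snd := by
  refine SimpleGraph.Reachable.trans h (SimpleGraph.Adj.reachable ?_)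
  rw [SimpleGraph.deleteEdges_adj]
  refine ⟨e.adj, fun h => ?_⟩
  rcases (SimpleGraph.dart_edge_eq_iff e d).1 h with h | h
  exacts [h₁ h, h₂ h]

theorem Dart.Behind.induction {d : G.Dart} {P : V → Prop} (h₀ : P d.fst)
    (h : ∀ e : G.Dart, e ≠ d → e ≠ d.symm → d.Behind e.fst → P e.fst → P e.snd) {w : V}
    (hw : d.Behind w) : P w := by
  have := (SimpleGraph.reachable_iff_reflTransGen _ _).1 hw
  induction this with
  | refl => exact h₀
  | @tail b c hb hbc ih =>
    have hb' : d.Behind b := (SimpleGraph.reachable_iff_reflTransGen _ _).2 hb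
    rw [SimpleGraph.deleteEdges_adj] at hbc
    refine h ⟨(b, c), hbc.1⟩ ?_ ?_ hb' (ih hb')
    · intro h
      have := congrArg SimpleGraph.Dart.edge h
      exact hbc.2 this
    · intro h
      apply hbc.2
      have := congrArg SimpleGraph.Dart.edge h
      rw [SimpleGraph.Dart.edge_symm] at this
      exact this

theorem Connected.dart_induction (hG : G.Connected) {P : V → Prop} {v : V} (h₀ : P v)
    (h : ∀ e : G.Dart, P e.fst → P e.snd) (w : V) : P w := by
  have := (SimpleGraph.reachable_iff_reflTransGen _ _).1 (hG.preconnected v w)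
  induction this with
  | refl => exact h₀
  | @tail b c hb hbc ih => exact h ⟨(b, c), hbc⟩ ih

theorem IsAcyclic.not_behind_snd (hG : G.IsAcyclic) (d : G.Dart) : ¬ d.Behind d.snd :=
  SimpleGraph.isBridge_iff.1 (SimpleGraph.isAcyclic_iff_forall_adj_isBridge.1 hG d.adj)

theorem Dart.Behind.not_behind_symm (hG : G.IsAcyclic) {d : G.Dart} {w : V} (h : d.Behind w) :
    ¬ d.symm.Behind w := by
  intro h'
  unfold Dart.Behind at h'
  rw [SimpleGraph.Dart.edge_symm] at h'
  exact hG.not_behind_snd d (SimpleGraph.Reachable.trans h (SimpleGraph.Reachable.symm h'))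

theorem Connected.behind_or_behind_symm (hG : G.Connected) (d : G.Dart) (w : V) :
    d.Behind w ∨ d.symm.Behind w := by
  refine hG.dart_induction (v := d.fst) (P := fun w => d.Behind w ∨ d.symm.Behind w)
    (Or.inl d.behind_fst) (fun e he => ?_) w
  by_cases h₁ : e = d
  · subst h₁
    exact Or.inr e.symm.behind_fst
  by_cases h₂ : e = d.symm
  · subst h₂
    exact Or.inl d.behind_fst
  refine he.imp (fun h => h.snd h₁ h₂) (fun h => h.snd h₂ (by simpa using h₁))

/-- The dart is the first edge on the way from `v` to `w`; along a walk it changes only when the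
walk returns to `v`. -/
theorem Connected.exists_dart_behind_symm (hG : G.Connected) {v w : V} (hvw : w ≠ v) :
    ∃ d : G.Dart, d.fst = v ∧ d.symm.Behind w := by
  refine (hG.dart_induction (v := v)
    (P := fun w => w = v ∨ ∃ d : G.Dart, d.fst = v ∧ d.symm.Behind w)
    (Or.inl rfl) (fun e he => ?_) w).resolve_left hvw
  rcases he with he | ⟨d, hd, he⟩
  · exact Or.inr ⟨e, he, e.symm.behind_fst⟩
  by_cases h₁ : e = d
  · subst h₁
    exact Or.inr ⟨e, hd, e.symm.behind_fst⟩
  by_cases h₂ : e = d.symm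
  · subst h₂
    exact Or.inl hd
  exact Or.inr ⟨d, hd, he.snd h₂ (by simpa using h₁)⟩

end SimpleGraph

/-! ### The sets `back d t`: separation, connectedness, compactness. -/

namespace ArcRealization

variable {V : Type*} {G : SimpleGraph V} {X : Type*} [TopologicalSpace X] (M : ArcRealization G X)

theorem arc_one (d : G.Dart) : M.arc d 1 = M.pt d.snd := by
  have := M.arc_symm d 0
  rw [unitInterval.symm_zero] at this
  rw [← this, M.arc_zero]
  rfl

theorem arc_symm_symm (d : G.Dart) (t : I) : M.arc d.symm (σ t) = M.arc d t := by
  rw [M.arc_symm, unitInterval.symm_symm]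

theorem pt_eq_arc {v : V} {d : G.Dart} {t : I} (h : M.pt v = M.arc d t) :
    (v = d.fst ∧ t = 0) ∨ (v = d.snd ∧ t = 1) := by
  by_cases h₀ : t = 0
  · subst h₀
    rw [M.arc_zero] at h
    exact Or.inl ⟨M.pt_injective h, rfl⟩
  by_cases h₁ : t = 1
  · subst h₁
    rw [M.arc_one] at h
    exact Or.inr ⟨M.pt_injective h, rfl⟩
  exact (M.pt_ne_arc v d t h₀ h₁ h).elim

/-- The part of the space that lies behind the point `arc d t`, when looking in the direction
of `d`. -/
def back (d : G.Dart) (t : I) : Set X :=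
  M.arc d '' Iic t ∪ ⋃ e ∈ {e : G.Dart | e ≠ d ∧ e ≠ d.symm ∧ d.Behind e.fst}, range (M.arc e)

variable {M}

theorem mem_back {d : G.Dart} {t : I} {x : X} : x ∈ M.back d t ↔ (∃ s ≤ t, M.arc d s = x) ∨
    ∃ e : G.Dart, e ≠ d ∧ e ≠ d.symm ∧ d.Behind e.fst ∧ ∃ s, M.arc e s = x := by
  simp only [back, mem_union, mem_image, mem_Iic, mem_iUnion, mem_ofPred_eq, mem_range,
    exists_prop, and_assoc]

theorem back_mono (d : G.Dart) {s t : I} (h : s ≤ t) : M.back d s ⊆ M.back d t := by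
  intro x hx
  rw [mem_back] at hx ⊢
  exact hx.imp_left fun ⟨r, hr, h'⟩ => ⟨r, hr.trans h, h'⟩

theorem arc_mem_back (d : G.Dart) {s t : I} (h : s ≤ t) : M.arc d s ∈ M.back d t :=
  mem_back.2 (Or.inl ⟨s, h, rfl⟩)

theorem arc_mem_back_symm (d : G.Dart) {s t : I} (h : t ≤ s) :
    M.arc d s ∈ M.back d.symm (σ t) := by
  rw [← M.arc_symm_symm]
  exact arc_mem_back _ (unitInterval.symm_le_symm.2 h)

/-- Only the initial piece of the arc of `d` depends on the parameter, so growth from `s` to `t`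
adds points of that arc alone. -/
theorem arc_eq_of_mem_back {d : G.Dart} {s t : I} {x : X} (h : x ∈ M.back d t)
    (h' : x ∉ M.back d s) : ∃ r, s < r ∧ r ≤ t ∧ M.arc d r = x := by
  rw [mem_back] at h h'
  push Not at h'
  rcases h with ⟨r, hr, rfl⟩ | ⟨e, h₁, h₂, h₃, r, hr⟩
  · exact ⟨r, lt_of_not_ge fun h => h'.1 r h rfl, hr, rfl⟩
  · exact (h'.2 e h₁ h₂ h₃ r hr).elim

theorem behind_of_pt_mem_range {d e : G.Dart} (h₁ : e ≠ d) (h₂ : e ≠ d.symm)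
    (h₃ : d.Behind e.fst) {v : V} {s : I} (h : M.arc e s = M.pt v) : d.Behind v := by
  rcases M.pt_eq_arc h.symm with ⟨rfl, -⟩ | ⟨rfl, -⟩
  exacts [h₃, h₃.snd h₁ h₂]

theorem back_union_back (hG : G.Connected) (d : G.Dart) (t : I) (x : X) :
    x ∈ M.back d t ∨ x ∈ M.back d.symm (σ t) := by
  obtain ⟨e, s, rfl⟩ := M.exists_arc_eq x
  by_cases h₁ : e = d
  · subst h₁
    exact (le_total s t).imp (arc_mem_back e) (arc_mem_back_symm e)
  by_cases h₂ : e = d.symm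
  · subst h₂
    rw [M.arc_symm]
    exact (le_total (σ s) t).imp (arc_mem_back d) (arc_mem_back_symm d)
  refine (hG.behind_or_behind_symm d e.fst).imp (fun h => ?_) (fun h => ?_)
  · exact mem_back.2 (Or.inr ⟨e, h₁, h₂, h, s, rfl⟩)
  · exact mem_back.2 (Or.inr ⟨e, h₂, by simpa using h₁, h, s, rfl⟩)

theorem eq_zero_or_one_of_arc_eq {d e : G.Dart} {s t : I} (h₁ : e ≠ d) (h₂ : e ≠ d.symm)
    (h : M.arc d s = M.arc e t) : s = 0 ∨ s = 1 := by
  by_contra! hs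
  rcases M.eq_or_eq_symm d e s t hs.1 hs.2 h with h | h
  exacts [h₁ h, h₂ h]

theorem eq_arc_of_mem_back_of_mem_range (hG : G.IsAcyclic) {d e : G.Dart} {s t : I} {x : X}
    (hs : s ≤ t) (hx : M.arc d s = x) (h₁ : e ≠ d) (h₂ : e ≠ d.symm)
    (h₃ : d.symm.Behind e.fst) {r : I} (hr : M.arc e r = x) : x = M.arc d t := by
  subst hx
  rcases eq_zero_or_one_of_arc_eq h₁ h₂ hr.symm with rfl | rfl
  · rw [M.arc_zero] at hr
    exact (d.behind_fst.not_behind_symm hG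
      (behind_of_pt_mem_range (d := d.symm) h₂ (by simpa using h₁) h₃ hr)).elim
  · rw [le_antisymm hs unitInterval.le_one']

/-- This is what makes `arc d t` a cut point. Arcs on different sides can meet only in a vertex, and
a vertex behind both `d` and `d.symm` would give a cycle through the edge of `d`. -/
theorem eq_arc_of_mem_back (hG : G.IsAcyclic) {d : G.Dart} {t : I} {x : X}
    (h : x ∈ M.back d t) (h' : x ∈ M.back d.symm (σ t)) : x = M.arc d t := by
  rw [mem_back] at h h'
  rcases h with ⟨s, hs, hx⟩ | ⟨e, h₁, h₂, h₃, s, hs⟩ <;>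
  rcases h' with ⟨s', hs', hx'⟩ | ⟨e', h₁', h₂', h₃', s', hs'⟩
  · rw [← hx, M.arc_symm] at hx'
    have := M.arc_injective d hx'
    have h' : t ≤ σ s' := by
      rw [← unitInterval.symm_le_symm, unitInterval.symm_symm]
      exact hs'
    rw [← hx, le_antisymm hs (this ▸ h')]
  · exact eq_arc_of_mem_back_of_mem_range hG hs hx (by simpa using h₂') h₁' h₃' hs'
  · rw [← M.arc_symm_symm]
    exact eq_arc_of_mem_back_of_mem_range hG hs' hx' h₂ (by simpa using h₁) (by simpa using h₃) hs
  · exfalso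
    have key : ∀ v, M.pt v = x → False := fun v hv =>
      (behind_of_pt_mem_range h₁ h₂ h₃ (hs.trans hv.symm)).not_behind_symm hG
        (behind_of_pt_mem_range h₁' h₂' h₃' (hs'.trans hv.symm))
    by_cases h₀ : s = 0
    · subst h₀
      exact key _ ((M.arc_zero e).symm.trans hs)
    by_cases h₁ : s = 1
    · subst h₁
      exact key _ ((M.arc_one e).symm.trans hs)
    rcases M.eq_or_eq_symm e e' s s' h₀ h₁ (hs.trans hs'.symm) with rfl | rfl
    · exact h₃.not_behind_symm hG h₃'
    · exact (h₃.snd ‹_› h₂).not_behind_symm hG h₃'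

theorem arc_notMem_back (hG : G.IsAcyclic) (d : G.Dart) {s t : I} (h : s < t) :
    M.arc d t ∉ M.back d s := fun h' =>
  h.ne' (M.arc_injective d (eq_arc_of_mem_back hG h' (arc_mem_back_symm d h.le)))

theorem notMem_back_of_mem (hG : G.IsAcyclic) {d : G.Dart} {s t : I} (h : s < t) {x : X}
    (hx : x ∈ M.back d.symm (σ t)) : x ∉ M.back d s := by
  intro h'
  have := eq_arc_of_mem_back hG (back_mono d h.le h') hx
  rw [this] at h'
  exact arc_notMem_back hG d h h'

theorem exists_mem_back_symm_of_notMem (hG : G.Connected) {d : G.Dart} {t : I} (ht : t < 1) {x : X}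
    (hx : x ∉ M.back d t) : ∃ s, t < s ∧ x ∈ M.back d.symm (σ s) := by
  by_cases h : x ∈ M.back d.symm (σ 1)
  · exact ⟨1, ht, h⟩
  · have h' := (back_union_back hG d t x).resolve_left hx
    obtain ⟨r, -, hr, rfl⟩ := arc_eq_of_mem_back h' h
    rw [M.arc_symm] at hx ⊢
    exact ⟨σ r, lt_of_not_ge fun h => hx (arc_mem_back d h), arc_mem_back_symm d le_rfl⟩

/-- The complement becomes a union of connected sets that all contain `pt d.snd`, hence it is
connected. At `t = 1` this fails, as the union is empty. -/
theorem compl_back (hG : G.IsTree) (d : G.Dart) {t : I} (ht : t < 1) :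
    (M.back d t)ᶜ = ⋃ s ∈ Ioi t, M.back d.symm (σ s) := by
  ext x
  simp only [mem_compl_iff, mem_iUnion, mem_Ioi, exists_prop]
  exact ⟨exists_mem_back_symm_of_notMem hG.connected ht, fun ⟨s, hs, h⟩ =>
    notMem_back_of_mem hG.isAcyclic hs h⟩

theorem isPreconnected_back (d : G.Dart) (t : I) : IsPreconnected (M.back d t) := by
  have hr : ∀ e, IsPreconnected (range (M.arc e)) := fun e =>
    isPreconnected_range (M.continuous_arc e)
  -- `S` is the union of the arcs along a route from `d.fst` to `w` that avoids the edge of `d`.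
  have hv : ∀ w, d.Behind w → ∃ S ⊆ M.back d t, M.pt d.fst ∈ S ∧ M.pt w ∈ S ∧ IsPreconnected S := by
    intro w hw
    refine hw.induction (P := fun w => ∃ S ⊆ M.back d t, M.pt d.fst ∈ S ∧ M.pt w ∈ S ∧
      IsPreconnected S) ⟨{M.pt d.fst}, ?_, rfl, rfl, isPreconnected_singleton⟩ ?_
    · rw [singleton_subset_iff, ← M.arc_zero]
      exact arc_mem_back d unitInterval.nonneg'
    · rintro e h₁ h₂ h₃ ⟨S, hS, h, h', hc⟩
      refine ⟨S ∪ range (M.arc e), union_subset hS ?_, Or.inl h,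
        Or.inr ⟨1, M.arc_one e⟩, hc.union (M.pt e.fst) h' ⟨0, M.arc_zero e⟩ (hr e)⟩
      rintro _ ⟨s, rfl⟩
      exact mem_back.2 (Or.inr ⟨e, h₁, h₂, h₃, s, rfl⟩)
  refine isPreconnected_of_forall (M.pt d.fst) fun y hy => ?_
  rcases mem_back.1 hy with ⟨s, hs, rfl⟩ | ⟨e, h₁, h₂, h₃, s, rfl⟩
  · refine ⟨M.arc d '' Iic t, subset_union_left, ⟨0, unitInterval.nonneg', M.arc_zero d⟩,
      ⟨s, hs, rfl⟩, ?_⟩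
    exact isPreconnected_Iic.image _ (M.continuous_arc d).continuousOn
  · obtain ⟨S, hS, h, h', hc⟩ := hv _ h₃
    refine ⟨S ∪ range (M.arc e), union_subset hS ?_, Or.inl h, Or.inr ⟨s, rfl⟩,
      hc.union (M.pt e.fst) h' ⟨0, M.arc_zero e⟩ (hr e)⟩
    rintro _ ⟨s, rfl⟩
    exact mem_back.2 (Or.inr ⟨e, h₁, h₂, h₃, s, rfl⟩)

theorem isPreconnected_compl_back (hG : G.IsTree) (d : G.Dart) {t : I} (ht : t < 1) :
    IsPreconnected (M.back d t)ᶜ := by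
  rw [compl_back hG d ht]
  rw [biUnion_eq_iUnion]
  refine isPreconnected_iUnion ⟨M.pt d.snd, mem_iInter.2 fun s => ?_⟩
    fun s => isPreconnected_back _ _
  rw [← M.arc_one]
  exact arc_mem_back_symm d unitInterval.le_one'

theorem isCompact_back [Finite V] (d : G.Dart) (t : I) : IsCompact (M.back d t) := by
  refine (isClosed_Iic.isCompact.image (M.continuous_arc d)).union
    (Set.Finite.isCompact_biUnion ?_ fun e _ => isCompact_range (M.continuous_arc e))
  have : Finite G.Dart := by
    cases nonempty_fintype V
    classical infer_instance
  exact Set.toFinite _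

/-- The points of a preconnected set all lie on the same side of `arc d t`. -/
theorem notMem_back_symm_of_isPreconnected [Finite V] [T2Space X] (hG : G.IsTree)
    {S : Set X} (hS : IsPreconnected S) {d : G.Dart} {t : I} (h : M.arc d t ∉ S) {x y : X}
    (hx : x ∈ S) (hy : y ∈ S) (hxd : x ∈ M.back d t) : y ∉ M.back d.symm (σ t) := by
  intro hyd
  have hx' : x ∉ M.back d.symm (σ t) := fun h' => h (eq_arc_of_mem_back hG.isAcyclic hxd h' ▸ hx)
  have hy' : y ∉ M.back d t := fun h' => h (eq_arc_of_mem_back hG.isAcyclic h' hyd ▸ hy)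
  -- Both sides are closed and share only `arc d t`, which is not in `S`; their complements would
  -- disconnect `S`.
  obtain ⟨z, hz, hz₁, hz₂⟩ := hS _ _ (isCompact_back (M := M) d t).isClosed.isOpen_compl
    (isCompact_back (M := M) d.symm (σ t)).isClosed.isOpen_compl (fun z hz => by
      by_contra! h'
      simp only [mem_union, mem_compl_iff, not_or, not_not] at h'
      exact h (eq_arc_of_mem_back hG.isAcyclic h'.1 h'.2 ▸ hz)) ⟨y, hy, hy'⟩ ⟨x, hx, hx'⟩
  exact (back_union_back hG.connected d t z).elim hz₁ hz₂

end ArcRealization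

/-! ### Directions at a point and the classification of the members of `NCStar X`. -/

namespace ArcRealization

section

variable {V : Type*} {G : SimpleGraph V} {X : Type*} [TopologicalSpace X] {M : ArcRealization G X}

variable (M) in
/-- The directions in which one can leave the point `p` along an arc of the realization. -/
def Direction (p : X) : Type _ := {q : G.Dart × I // q.2 < 1 ∧ M.arc q.1 q.2 = p}

theorem arc_mem_back_of_fst_eq {d e : G.Dart} (h : d.fst = e.fst) (hde : d ≠ e) (s t : I) :
    M.arc d s ∈ M.back e t := by
  refine mem_back.2 (Or.inr ⟨d, hde, ?_, h ▸ e.behind_fst, s, rfl⟩)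
  rintro rfl
  exact e.adj.ne h.symm

/-- Two directions at the same point are equal, or come from darts with the same source, or are
opposite directions at an inner point of an arc. -/
theorem direction_cases {d e : G.Dart} {s t : I} (hs : s < 1) (ht : t < 1)
    (h : M.arc d s = M.arc e t) : (d = e ∧ s = t) ∨ (d.fst = e.fst ∧ d ≠ e ∧ s = 0 ∧ t = 0) ∨
    (e = d.symm ∧ t = σ s ∧ s ≠ 0) := by
  by_cases h₀ : s = 0
  · subst h₀
    rw [M.arc_zero] at h
    rcases M.pt_eq_arc h with ⟨h₁, rfl⟩ | ⟨-, rfl⟩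
    · by_cases hde : d = e
      · exact Or.inl ⟨hde, rfl⟩
      · exact Or.inr (Or.inl ⟨h₁, hde, rfl, rfl⟩)
    · exact (lt_irrefl _ ht).elim
  · rcases M.eq_or_eq_symm d e s t h₀ hs.ne h with rfl | rfl
    · exact Or.inl ⟨rfl, M.arc_injective _ h⟩
    · refine Or.inr (Or.inr ⟨rfl, ?_, h₀⟩)
      rw [M.arc_symm] at h
      rw [M.arc_injective _ h, unitInterval.symm_symm]

/-- The branches at `p`, that is, the complements of the sets `back d t` over all directions at `p`,
cover everything except `p`. -/
theorem exists_direction_notMem_back (hG : G.IsTree) {p x : X} (hx : x ≠ p) :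
    ∃ (d : G.Dart) (t : I), t < 1 ∧ M.arc d t = p ∧ x ∉ M.back d t := by
  -- The case where `p` is a vertex, written as the source of a dart. The last clause is conditional
  -- so that `key` can be stated before `p` is split into cases.
  have key : ∀ d : G.Dart, ∃ (e : G.Dart) (t : I),
      t < 1 ∧ M.arc e t = M.pt d.fst ∧ (x ≠ M.pt d.fst → x ∉ M.back e t) := by
    intro d
    obtain ⟨f, s, rfl⟩ := M.exists_arc_eq x
    by_cases hf : f.fst = d.fst
    · refine ⟨f, 0, zero_lt_one, by rw [M.arc_zero, hf], fun h => arc_notMem_back hG.isAcyclic f ?_⟩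
      refine lt_of_le_of_ne unitInterval.nonneg' ?_
      rintro rfl
      rw [M.arc_zero, hf] at h
      exact h rfl
    · obtain ⟨e, he, he'⟩ := hG.connected.exists_dart_behind_symm hf
      refine ⟨e, 0, zero_lt_one, by rw [M.arc_zero, he], fun h h' => h ?_⟩
      rw [← he, ← M.arc_zero]
      refine eq_arc_of_mem_back hG.isAcyclic h' ?_
      rw [unitInterval.symm_zero]
      by_cases h₁ : f = e
      · subst h₁
        exact (hf he).elim
      by_cases h₂ : f = e.symm
      · subst h₂
        exact arc_mem_back _ unitInterval.le_one'
      · exact mem_back.2 (Or.inr ⟨f, h₂, by simpa using h₁, he', s, rfl⟩)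
  obtain ⟨d, t, rfl⟩ := M.exists_arc_eq p
  by_cases h₀ : t = 0
  · subst h₀
    obtain ⟨e, t, ht, h, h'⟩ := key d
    rw [M.arc_zero] at hx ⊢
    exact ⟨e, t, ht, h, h' hx⟩
  by_cases h₁ : t = 1
  · subst h₁
    obtain ⟨e, t, ht, h, h'⟩ := key d.symm
    rw [M.arc_one] at hx ⊢
    exact ⟨e, t, ht, h, h' hx⟩
  by_cases h : x ∈ M.back d t
  · refine ⟨d.symm, σ t, ?_, M.arc_symm_symm d t, fun h' => hx (eq_arc_of_mem_back hG.isAcyclic h h')⟩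
    rw [← unitInterval.symm_zero, unitInterval.symm_lt_symm]
    exact unitInterval.pos_iff_ne_zero.2 h₀
  · exact ⟨d, t, unitInterval.lt_one_iff_ne_one.2 h₁, rfl, h⟩

theorem arc_mem_closure_compl_back (hG : G.IsTree) (d : G.Dart) {t : I} (ht : t < 1) :
    M.arc d t ∈ closure (M.back d t)ᶜ := by
  have h : t ∈ closure (Ioi t) := by
    rw [closure_Ioi' (⟨1, ht⟩ : (Ioi t).Nonempty)]
    exact self_mem_Ici
  refine map_mem_closure (M.continuous_arc d) h fun s hs => ?_
  exact arc_notMem_back hG.isAcyclic d hs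

/-- A leaf has a single direction, which points back along `d`; a point outside `back d 1` would
need another one. -/
theorem back_one_eq_univ (hG : G.IsTree) {d : G.Dart} (hd : ∀ e : G.Dart, e.fst = d.snd → e = d.symm) :
    M.back d 1 = univ := by
  refine eq_univ_of_forall fun x => ?_
  by_contra hx
  obtain ⟨e, t, ht, h, hx'⟩ := exists_direction_notMem_back (M := M) hG (x := x) (p := M.arc d 1)
    (fun h => hx (h ▸ arc_mem_back d le_rfl))
  have h' : M.arc d.symm 0 = M.arc e t := by rw [h, M.arc_symm, unitInterval.symm_zero]
  have h'' := (back_union_back hG.connected d 1 x).resolve_left hx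
  rw [unitInterval.symm_one] at h''
  rcases direction_cases zero_lt_one ht h' with ⟨rfl, rfl⟩ | ⟨h₁, h₂, -⟩ | ⟨-, -, h₀⟩
  · exact hx' h''
  · exact h₂ (hd e h₁.symm).symm
  · exact h₀ rfl

theorem back_ne_univ (hG : G.IsTree) (d : G.Dart) {t : I} (ht : t < 1) : M.back d t ≠ univ :=
  fun h => arc_notMem_back (M := M) hG.isAcyclic d ht (h ▸ mem_univ _)

theorem finite_dart [Finite V] : Finite G.Dart := by
  cases nonempty_fintype V
  classical infer_instance

theorem finite_direction [Finite V] (p : X) : Finite (M.Direction p) := by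
  have : Finite G.Dart := finite_dart
  refine Finite.of_injective (fun q : M.Direction p => q.1.1) ?_
  rintro ⟨⟨d, s⟩, hs, h⟩ ⟨⟨e, t⟩, ht, h'⟩ rfl
  exact Subtype.ext (Prod.ext rfl (M.arc_injective _ (h.trans h'.symm)))

end

section

variable {V : Type*} [Finite V] {G : SimpleGraph V} {X : Type*} [TopologicalSpace X] [T2Space X]
  {M : ArcRealization G X}

theorem _root_.IsPreconnected.inter_frontier_nonempty_of_isOpen {Y : Type*} [TopologicalSpace Y]
    {S W : Set Y} (hS : IsPreconnected S) (hW : IsOpen W) (h : (S ∩ W).Nonempty)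
    (h' : (S ∩ Wᶜ).Nonempty) : (S ∩ frontier W).Nonempty := by
  by_contra hne
  have hcl : ∀ x ∈ S, x ∈ closure W → x ∈ W := fun x hx hxW => by
    by_contra hxW'
    exact hne ⟨x, hx, by rw [hW.frontier_eq]; exact ⟨hxW, hxW'⟩⟩
  obtain ⟨x, hx, hxW⟩ := h'
  obtain ⟨z, -, hz, hz'⟩ := hS W (closure W)ᶜ hW isClosed_closure.isOpen_compl
    (fun x hx => or_iff_not_imp_left.2 fun h h' => h (hcl x hx h')) h
    ⟨x, hx, fun h => hxW (hcl x hx h)⟩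
  exact hz' (subset_closure hz)

theorem isClosed_back (d : G.Dart) (t : I) : IsClosed (M.back d t) := (isCompact_back d t).isClosed

/-- Branches at the same point in different directions are disjoint. -/
theorem mem_back_of_direction_ne (hG : G.IsTree) {d e : G.Dart} {s t : I} (hs : s < 1) (ht : t < 1)
    (h : M.arc d s = M.arc e t) (hne : ¬ (d = e ∧ s = t)) {x : X} (hx : x ∉ M.back d s) :
    x ∈ M.back e t := by
  rcases direction_cases hs ht h with h' | ⟨h₁, hde, rfl, rfl⟩ | ⟨rfl, rfl, -⟩
  · exact (hne h').elim
  · by_contra hx'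
    -- The far end of `d` is in the branch of `d` but behind `e`. The branch of `d` is connected and
    -- misses the common point, so it cannot also reach ahead along `e`.
    have h1 : M.arc d 1 ∉ M.back d 0 := arc_notMem_back hG.isAcyclic d zero_lt_one
    have := (back_union_back hG.connected e 0 x).resolve_left hx'
    refine notMem_back_symm_of_isPreconnected hG (isPreconnected_compl_back (M := M) hG d hs)
      (d := e) (t := 0) ?_ h1 hx (arc_mem_back_of_fst_eq h₁ hde _ _) this
    rw [← h]
    exact fun h => h (arc_mem_back d le_rfl)
  · exact (back_union_back hG.connected d s x).resolve_left hx

theorem subset_compl_back (hG : G.IsTree) {U : Set X} (hU : IsPreconnected U) (hne : U.Nonempty)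
    {p : X} (hp : p ∉ U) : ∃ (d : G.Dart) (t : I), t < 1 ∧ M.arc d t = p ∧ U ⊆ (M.back d t)ᶜ := by
  obtain ⟨x, hx⟩ := hne
  obtain ⟨d, t, ht, rfl, hxd⟩ := exists_direction_notMem_back (M := M) hG (x := x) (p := p)
    (fun h => hp (h ▸ hx))
  exact ⟨d, t, ht, rfl, fun y hy hy' => notMem_back_symm_of_isPreconnected hG hU hp hy hx hy'
    ((back_union_back hG.connected d t x).resolve_left hxd)⟩

theorem exists_eq_back (hG : G.IsTree) [PreconnectedSpace X] {A : Set X} (hA : IsClosed A)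
    (hAc : IsConnected A) (hA' : IsPreconnected Aᶜ) (hne : A ≠ univ) :
    ∃ (d : G.Dart) (t : I), t < 1 ∧ A = M.back d t := by
  obtain ⟨p, hp⟩ := (nonempty_frontier_iff (s := A)).2 ⟨hAc.nonempty, hne⟩
  have hpA : p ∈ A := hA.frontier_subset hp
  have hpU : p ∈ closure Aᶜ := frontier_subset_closure (frontier_compl A ▸ hp)
  obtain ⟨d, t, ht, rfl, hU⟩ := subset_compl_back (M := M) hG hA'
    (nonempty_compl.2 hne) (p := p) (fun h => h hpA)
  refine ⟨d, t, ht, Subset.antisymm (fun q hq => ?_) (compl_subset_compl.1 hU)⟩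
  by_contra hqd
  obtain ⟨s, hs, hqs⟩ := exists_mem_back_symm_of_notMem hG.connected ht hqd
  -- Since `p = arc d t` is a limit of the complement of `A`, some point `u` of that complement lies
  -- on the arc after `t` and not beyond `s`. It separates `p` from `q`, although both are in the
  -- connected set `A`.
  obtain ⟨u, hu, huA⟩ := mem_closure_iff.1 hpU _ (isClosed_back (M := M) d.symm (σ s)).isOpen_compl
    (fun h => notMem_back_of_mem hG.isAcyclic hs h (arc_mem_back d le_rfl))
  obtain ⟨r, htr, hrs, rfl⟩ := arc_eq_of_mem_back
    ((back_union_back hG.connected d s u).resolve_right hu) (hU huA)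
  have hqr : q ∈ M.back d.symm (σ r) := back_mono _ (unitInterval.symm_le_symm.2 hrs) hqs
  exact notMem_back_symm_of_isPreconnected hG hAc.isPreconnected huA hpA hq
    (arc_mem_back d htr.le) hqr

theorem closure_compl_back_subset (hG : G.IsTree) (d : G.Dart) (t : I) :
    closure (M.back d t)ᶜ ⊆ M.back d.symm (σ t) :=
  closure_minimal (fun x hx => (back_union_back hG.connected d t x).resolve_left hx)
    (isClosed_back _ _)

/-- The point `arc d s` is recovered from the set as the only point that also lies in the closure of
the complement; the direction is then determined because distinct branches are disjoint. -/
theorem back_injective (hG : G.IsTree) {d e : G.Dart} {s t : I} (hs : s < 1) (ht : t < 1)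
    (h : M.back d s = M.back e t) : d = e ∧ s = t := by
  have hp : M.arc d s = M.arc e t := by
    refine eq_arc_of_mem_back hG.isAcyclic (h ▸ arc_mem_back d le_rfl) ?_
    exact closure_compl_back_subset hG e t (h ▸ arc_mem_closure_compl_back hG d hs)
  by_contra hne
  have h1 : M.arc d 1 ∉ M.back d s := arc_notMem_back hG.isAcyclic d hs
  exact h1 (h ▸ mem_back_of_direction_ne hG hs ht hp hne h1)

/-- The far ends of `e` and `f` survive in the complement, while their common source, which
separates them, is in `back d 1`. -/
theorem not_isPreconnected_compl_back_one (hG : G.IsTree) {d e f : G.Dart} (he : e.fst = d.snd)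
    (hf : f.fst = d.snd) (hed : e ≠ d.symm) (hfd : f ≠ d.symm) (hef : e ≠ f) :
    ¬ IsPreconnected (M.back d 1)ᶜ := by
  intro hc
  have key : ∀ e : G.Dart, e.fst = d.snd → e ≠ d.symm → M.arc e 1 ∈ (M.back d 1)ᶜ := by
    intro e he hed h
    have h' : M.arc e 1 ∈ M.back d.symm (σ 1) := arc_mem_back_of_fst_eq he hed _ _
    have := eq_arc_of_mem_back hG.isAcyclic h h'
    rw [M.arc_one, M.arc_one] at this
    exact e.adj.ne (he.trans (M.pt_injective this).symm)
  refine notMem_back_symm_of_isPreconnected hG hc (d := f) (t := 0) ?_ (key e he hed)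
    (key f hf hfd) (arc_mem_back_of_fst_eq (he.trans hf.symm) hef _ _)
    (arc_mem_back_symm f unitInterval.nonneg')
  rw [M.arc_zero, hf, ← M.arc_one]
  exact fun h => h (arc_mem_back d le_rfl)

end

/-! ### The Menger–Urysohn order as the number of directions. -/

section

universe u

variable {V X : Type u} [Finite V] {G : SimpleGraph V} [TopologicalSpace X] [T2Space X]
  {M : ArcRealization G X}

theorem mk_direction_le (hG : G.IsTree) {p : X} {κ : Cardinal}
    (h : ∀ U : Set X, IsOpen U → p ∈ U →
      ∃ W : Set X, IsOpen W ∧ p ∈ W ∧ W ⊆ U ∧ Cardinal.mk (frontier W) ≤ κ) :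
    Cardinal.mk (M.Direction p) ≤ κ := by
  have := finite_direction (M := M) p
  -- The neighborhood omits the far end of every direction, so each arc leaving `p` has to cross the
  -- frontier of `W`. The crossings are distinct because the branches are disjoint.
  obtain ⟨W, hW, hpW, hWU, hκ⟩ := h (⋃ q : M.Direction p, {M.arc q.1.1 1})ᶜ
    (isClosed_iUnion_of_finite fun _ => isClosed_singleton).isOpen_compl (by
      simp only [mem_compl_iff, mem_iUnion, mem_singleton_iff, not_exists]
      rintro ⟨⟨d, t⟩, ht, h⟩ h'
      exact ht.ne (M.arc_injective _ (h.trans h')))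
  have key : ∀ q : M.Direction p, ∃ s, q.1.2 < s ∧ M.arc q.1.1 s ∈ frontier W := by
    rintro ⟨⟨d, t⟩, ht, rfl⟩
    have hc : IsPreconnected (M.arc d '' Icc t 1) :=
      isPreconnected_Icc.image _ (M.continuous_arc d).continuousOn
    obtain ⟨_, ⟨s, hs, rfl⟩, hsW⟩ := hc.inter_frontier_nonempty_of_isOpen hW
      ⟨_, ⟨t, left_mem_Icc.2 ht.le, rfl⟩, hpW⟩ ⟨_, ⟨1, right_mem_Icc.2 ht.le, rfl⟩, fun h =>
        hWU h (mem_iUnion.2 ⟨⟨⟨d, t⟩, ht, rfl⟩, rfl⟩)⟩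
    refine ⟨s, lt_of_le_of_ne hs.1 ?_, hsW⟩
    rintro rfl
    rw [hW.frontier_eq] at hsW
    exact hsW.2 hpW
  choose s hs hsW using key
  refine le_trans (Cardinal.mk_le_of_injective (f := fun q => (⟨_, hsW q⟩ : frontier W)) ?_) hκ
  intro q r hqr
  by_contra hne
  have hqr' : M.arc q.1.1 (s q) = M.arc r.1.1 (s r) := congrArg Subtype.val hqr
  have h₁ : M.arc q.1.1 (s q) ∉ M.back q.1.1 q.1.2 := arc_notMem_back hG.isAcyclic _ (hs q)
  have h₂ : M.arc r.1.1 (s r) ∉ M.back r.1.1 r.1.2 := arc_notMem_back hG.isAcyclic _ (hs r)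
  refine h₂ (hqr' ▸ mem_back_of_direction_ne hG q.2.1 r.2.1 (q.2.2.trans r.2.2.symm) ?_ h₁)
  rintro ⟨h, h'⟩
  exact hne (Subtype.ext (Prod.ext h h'))

/-- Each branch at `p` is cut off at a point `arc d (s q)` so near that the arc up to there stays in
`U`. Only the cut points can be in the frontier. -/
theorem exists_frontier_le_mk_direction (hG : G.IsTree) {p : X} {U : Set X} (hU : IsOpen U)
    (hp : p ∈ U) : ∃ W : Set X, IsOpen W ∧ p ∈ W ∧ W ⊆ U ∧
      Cardinal.mk (frontier W) ≤ Cardinal.mk (M.Direction p) := by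
  have := finite_direction (M := M) p
  have key : ∀ q : M.Direction p, ∃ s, q.1.2 < s ∧ ∀ r, q.1.2 ≤ r → r ≤ s → M.arc q.1.1 r ∈ U := by
    rintro ⟨⟨d, t⟩, ht, rfl⟩
    have : M.arc d ⁻¹' U ∈ nhds t := (hU.preimage (M.continuous_arc d)).mem_nhds hp
    obtain ⟨u, hu, h⟩ := exists_Ico_subset_of_mem_nhds this ⟨1, ht⟩
    obtain ⟨s, hs, hsu⟩ := exists_between hu
    exact ⟨s, hs, fun r hr hr' => h ⟨hr, hr'.trans_lt hsu⟩⟩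
  choose s hs hsU using key
  have hmem : ∀ x ∈ ⋂ q : M.Direction p, M.back q.1.1 (s q), x ≠ p →
      ∃ q : M.Direction p, ∃ r, q.1.2 < r ∧ r ≤ s q ∧ M.arc q.1.1 r = x := by
    intro x hx hxp
    obtain ⟨d, t, ht, h, hxd⟩ := exists_direction_notMem_back (M := M) hG hxp
    exact ⟨⟨⟨d, t⟩, ht, h⟩, arc_eq_of_mem_back (mem_iInter.1 hx ⟨⟨d, t⟩, ht, h⟩) hxd⟩
  have hsub : ⋂ q : M.Direction p, (M.back q.1.1.symm (σ (s q)))ᶜ ⊆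
      ⋂ q : M.Direction p, M.back q.1.1 (s q) :=
    iInter_mono fun q x hx => (back_union_back hG.connected _ _ x).resolve_right hx
  have hpW : p ∈ ⋂ q : M.Direction p, (M.back q.1.1.symm (σ (s q)))ᶜ := by
    refine mem_iInter.2 fun q h => notMem_back_of_mem hG.isAcyclic (hs q) h ?_
    have h' := arc_mem_back (M := M) q.1.1 (le_refl q.1.2)
    rwa [q.2.2] at h'
  have hW : IsOpen (⋂ q : M.Direction p, (M.back q.1.1.symm (σ (s q)))ᶜ) :=
    isOpen_iInter_of_finite fun q => (isClosed_back _ _).isOpen_compl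
  refine ⟨_, hW, hpW, fun x hx => ?_, ?_⟩
  · by_cases hxp : x = p
    · rwa [hxp]
    · obtain ⟨q, r, hr, hr', rfl⟩ := hmem x (hsub hx) hxp
      exact hsU q r hr.le hr'
  · refine le_trans (Cardinal.mk_le_mk_of_subset (t := range fun q : M.Direction p =>
      M.arc q.1.1 (s q)) ?_) Cardinal.mk_range_le
    rw [hW.frontier_eq]
    rintro x ⟨hx, hx'⟩
    have hx := closure_minimal hsub (isClosed_iInter fun q => isClosed_back _ _) hx
    simp only [mem_iInter, mem_compl_iff, not_forall, not_not] at hx'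
    obtain ⟨q, hq⟩ := hx'
    exact ⟨q, (eq_arc_of_mem_back hG.isAcyclic (mem_iInter.1 hx q) hq).symm⟩

theorem mengerOrder_eq (hG : G.IsTree) (p : X) : mengerOrder p = Cardinal.mk (M.Direction p) := by
  refine le_antisymm (csInf_le' fun U hU hp => exists_frontier_le_mk_direction hG hU hp) ?_
  exact le_csInf ⟨_, fun U hU hp => exists_frontier_le_mk_direction (M := M) hG hU hp⟩
    fun κ h => mk_direction_le hG h

end

end ArcRealization

/-! ### Assembling paths into a cone and half-open intervals. -/

theorem isClosedMap_sigma_of_finite {ι Y : Type*} [Finite ι] {Z : ι → Type*}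
    [∀ i, TopologicalSpace (Z i)] [TopologicalSpace Y] {f : (Σ i, Z i) → Y}
    (hf : ∀ i, IsClosedMap fun z => f ⟨i, z⟩) : IsClosedMap f := by
  intro C hC
  have : f '' C = ⋃ i, (fun z => f ⟨i, z⟩) '' (Sigma.mk i ⁻¹' C) := by
    ext y
    simp only [mem_image, mem_iUnion, mem_preimage, Sigma.exists]
  rw [this]
  exact isClosed_iUnion_of_finite fun i => hf i _ (hC.preimage continuous_sigmaMk)

/-- A path in a Hausdorff space that leaves the set `S` only at time `1` restricts to a closed map
from `[0,1)` to `S`. -/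
theorem isClosedMap_Ico_of_mem_iff {Y : Type*} [TopologicalSpace Y] [T2Space Y] {S : Set Y}
    {g : I → Y} (hg : Continuous g) (hS : ∀ t, g t ∈ S ↔ t < 1) {f : Ico (0 : ℝ) 1 → S}
    (hf : ∀ t, (f t : Y) = g ⟨t, Ico_subset_Icc_self t.2⟩) : IsClosedMap f := by
  intro C hC
  let i : Ico (0 : ℝ) 1 → I := fun t => ⟨t, Ico_subset_Icc_self t.2⟩
  have hi : Topology.IsEmbedding i := Topology.IsEmbedding.inclusion Ico_subset_Icc_self
  obtain ⟨D, hD, rfl⟩ := hi.isInducing.isClosed_iff.1 hC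
  -- The image is the trace on `S` of the closed set `g '' D`; the parameter `1`, absent from the
  -- half-open interval, contributes nothing since `g 1` is not in `S`.
  have : f '' (i ⁻¹' D) = Subtype.val ⁻¹' (g '' D) := by
    ext y
    constructor
    · rintro ⟨t, ht, rfl⟩
      exact ⟨_, ht, (hf t).symm⟩
    · rintro ⟨t, ht, hty⟩
      have ht' : t < 1 := (hS t).1 (hty ▸ y.2)
      exact ⟨⟨t, t.2.1, ht'⟩, ht, Subtype.ext ((hf _).trans hty)⟩
  rw [this]
  exact (hg.isClosedMap D hD).preimage continuous_subtype_val

/-- A set that is swept out by `n` paths ending in a common point and by `N` paths ending outside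
of the set is the disjoint union of a cone over `n` points and of `N` half-open intervals. -/
theorem nonempty_homeomorph_cone_sum_Ico {Y : Type*} [TopologicalSpace Y] [T2Space Y] {S : Set Y}
    {n N : ℕ} (hn : 0 < n) {F : Fin n ⊕ Fin N → I → Y} (hF : ∀ a, Continuous (F a)) {y₀ : Y}
    (hl : ∀ i t, F (Sum.inl i) t ∈ S) (hl₁ : ∀ i, F (Sum.inl i) 1 = y₀)
    (hr : ∀ j t, F (Sum.inr j) t ∈ S ↔ t < 1)
    (hinj : ∀ a b s t, s < 1 → t < 1 → F a s = F b t → a = b ∧ s = t)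
    (hne : ∀ a t, t < 1 → F a t ≠ y₀) (hsurj : ∀ y ∈ S, y = y₀ ∨ ∃ a t, t < 1 ∧ F a t = y) :
    Nonempty (S ≃ₜ TopologicalCone (Fin n) ⊕ (Σ _ : Fin N, Ico (0 : ℝ) 1)) := by
  let f : TopologicalCone (Fin n) → S := Quotient.lift
    (fun p : Fin n × I => (⟨F (Sum.inl p.1) p.2, hl p.1 p.2⟩ : S)) (by
      rintro ⟨i, s⟩ ⟨j, t⟩ (h | ⟨h₁, h₂⟩)
      · rw [h]
      · obtain rfl : s = 1 := h₁
        obtain rfl : t = 1 := h₂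
        exact Subtype.ext ((hl₁ i).trans (hl₁ j).symm))
  have hf : Continuous f := by
    refine Continuous.quotient_lift (Continuous.subtype_mk ?_ _) _
    exact continuous_prod_of_discrete_left.2 fun i => hF (Sum.inl i)
  let g : (Σ _ : Fin N, Ico (0 : ℝ) 1) → S := fun q =>
    ⟨F (Sum.inr q.1) ⟨q.2, Ico_subset_Icc_self q.2.2⟩, (hr _ _).2 q.2.2.2⟩
  have hg : Continuous g := by
    refine continuous_sigma fun j => Continuous.subtype_mk ((hF (Sum.inr j)).comp
      (Continuous.subtype_mk continuous_subtype_val fun t => Ico_subset_Icc_self t.2)) _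
  have hgc : IsClosedMap g := isClosedMap_sigma_of_finite fun j =>
    isClosedMap_Ico_of_mem_iff (hF (Sum.inr j)) (hr j) fun _ => rfl
  have hmk : ∀ i s j t, F (Sum.inl i) s = F (Sum.inl j) t →
      (⟦(i, s)⟧ : TopologicalCone (Fin n)) = ⟦(j, t)⟧ := by
    intro i s j t h
    refine Quotient.sound ?_
    rcases eq_or_ne s 1 with rfl | hs <;> rcases eq_or_ne t 1 with rfl | ht
    · exact Or.inr ⟨rfl, rfl⟩
    · exact (hne _ _ (unitInterval.lt_one_iff_ne_one.2 ht) (h ▸ hl₁ i)).elim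
    · exact (hne _ _ (unitInterval.lt_one_iff_ne_one.2 hs) (h ▸ hl₁ j)).elim
    · obtain ⟨hij, rfl⟩ := hinj _ _ _ _ (unitInterval.lt_one_iff_ne_one.2 hs)
        (unitInterval.lt_one_iff_ne_one.2 ht) h
      exact Or.inl (by rw [Sum.inl_injective hij])
  have hdisj : ∀ i s j t, t < 1 → F (Sum.inl i) s ≠ F (Sum.inr j) t := by
    intro i s j t ht h
    rcases eq_or_ne s 1 with rfl | hs
    · exact hne _ _ ht (h ▸ hl₁ i)
    · exact Sum.inl_ne_inr (hinj _ _ _ _ (unitInterval.lt_one_iff_ne_one.2 hs) ht h).1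
  have hbij : Function.Bijective (Sum.elim f g) := by
    constructor
    · rintro (x | ⟨j, s⟩) (y | ⟨j', t⟩) h
      · induction x using Quotient.inductionOn with | h p =>
        induction y using Quotient.inductionOn with | h q =>
        exact congrArg Sum.inl (hmk _ _ _ _ (congrArg Subtype.val h))
      · induction x using Quotient.inductionOn with | h p =>
        exact (hdisj _ _ _ _ t.2.2 (congrArg Subtype.val h)).elim
      · induction y using Quotient.inductionOn with | h p =>
        exact (hdisj _ _ _ _ s.2.2 (congrArg Subtype.val h).symm).elim
      · obtain ⟨h₁, h₂⟩ := hinj _ _ _ _ s.2.2 t.2.2 (congrArg Subtype.val h)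
        obtain rfl := Sum.inr_injective h₁
        obtain rfl : s = t := Subtype.ext (congrArg (fun r : I => (r : ℝ)) h₂)
        rfl
    · rintro ⟨y, hy⟩
      rcases hsurj y hy with rfl | ⟨i | j, t, ht, rfl⟩
      · exact ⟨Sum.inl ⟦(⟨0, hn⟩, 1)⟧, Subtype.ext (hl₁ _)⟩
      · exact ⟨Sum.inl ⟦(i, t)⟧, rfl⟩
      · exact ⟨Sum.inr ⟨j, t, t.2.1, ht⟩, rfl⟩
  -- On the cone closedness is automatic, as the cone is compact and `S` is Hausdorff.
  exact ⟨(IsHomeomorph.homeomorph _ (isHomeomorph_iff_continuous_isClosedMap_bijective.2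
    ⟨hf.sumElim hg, hf.isClosedMap.sumElim hgc, hbij⟩)).symm⟩

/-! ### Continuity of `t ↦ back d t`; degrees and orders. -/

namespace ArcRealization

section

variable {V : Type*} [Finite V] {G : SimpleGraph V} {X : Type*} [TopologicalSpace X]
  {M : ArcRealization G X}

variable (M) in
/-- `back d t` as a nonempty compact set. -/
def backCompacts (d : G.Dart) (t : I) : NonemptyCompacts X :=
  ⟨⟨M.back d t, isCompact_back d t⟩, ⟨_, arc_mem_back d le_rfl⟩⟩

theorem coe_backCompacts (d : G.Dart) (t : I) :
    (M.backCompacts d t : Set X) = M.back d t := rfl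

theorem backCompacts_inj {d e : G.Dart} {s t : I} :
    M.backCompacts d s = M.backCompacts e t ↔ M.back d s = M.back e t :=
  SetLike.coe_set_eq.symm

theorem continuous_backCompacts (d : G.Dart) : Continuous (M.backCompacts d) := by
  -- The initial piece of the arc up to `t` is the image of all of `I` under `s ↦ arc d (s ⊓ t)`: a
  -- fixed compact set under a map varying continuously with `t`.
  have hc : Continuous (fun t s : I => M.arc d (s ⊓ t)).uncurry :=
    (M.continuous_arc d).comp (continuous_snd.inf continuous_fst)
  have h := (continuous_const (y := M.backCompacts d 0)).sup
    (Continuous.nonemptyCompacts_map' (continuous_const (y := (⊤ : NonemptyCompacts I))) hc)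
  convert h using 2 with t
  refine SetLike.coe_injective ?_
  ext x
  simp only [coe_backCompacts, NonemptyCompacts.coe_sup, NonemptyCompacts.coe_map,
    NonemptyCompacts.coe_top, image_univ, mem_union, mem_range]
  constructor
  · intro hx
    by_cases h₀ : x ∈ M.back d 0
    · exact Or.inl h₀
    · obtain ⟨r, -, hr, rfl⟩ := arc_eq_of_mem_back hx h₀
      exact Or.inr ⟨r, by rw [inf_eq_left.2 hr]⟩
  · rintro (hx | ⟨s, rfl⟩)
    · exact back_mono d unitInterval.nonneg' hx
    · exact arc_mem_back d inf_le_right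

theorem backCompacts_mem_NCStar (hG : G.IsTree) (d : G.Dart) {t : I} (ht : t < 1) :
    M.backCompacts d t ∈ NCStar X :=
  ⟨⟨⟨_, arc_mem_back d le_rfl⟩, isPreconnected_back d t⟩, isPreconnected_compl_back hG d ht⟩

end

section

universe u

variable {V X : Type u} [Fintype V] [DecidableEq V] {G : SimpleGraph V} [DecidableRel G.Adj]
  [TopologicalSpace X] {M : ArcRealization G X}

/-- The condition `t < 1` in `Direction` discards the darts that arrive at `v`, so each incident
edge counts once. -/
theorem mk_direction_pt (v : V) : Cardinal.mk (M.Direction (M.pt v)) = G.degree v := by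
  rw [← G.dart_fst_fiber_card_eq_degree v, ← Fintype.card_subtype, ← Cardinal.mk_fintype]
  have key : ∀ q : M.Direction (M.pt v), q.1.1.fst = v ∧ q.1.2 = 0 := by
    rintro ⟨⟨d, t⟩, ht, h⟩
    rcases M.pt_eq_arc h.symm with ⟨h', h⟩ | ⟨-, h⟩
    exacts [⟨h'.symm, h⟩, (ht.ne h).elim]
  refine Cardinal.mk_congr (Equiv.ofBijective (fun q => ⟨q.1.1, (key q).1⟩) ⟨?_, ?_⟩)
  · intro q r h
    exact Subtype.ext (Prod.ext (congrArg Subtype.val h) ((key q).2.trans (key r).2.symm))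
  · rintro ⟨d, rfl⟩
    exact ⟨⟨⟨d, 0⟩, zero_lt_one, M.arc_zero d⟩, rfl⟩

omit [Fintype V] [DecidableEq V] [DecidableRel G.Adj] in
theorem mk_direction_arc (d : G.Dart) {t : I} (h₀ : t ≠ 0) (h₁ : t ≠ 1) :
    Cardinal.mk (M.Direction (M.arc d t)) = 2 := by
  rw [Cardinal.mk_eq_two_iff]
  have h₁' : t < 1 := unitInterval.lt_one_iff_ne_one.2 h₁
  have h₀' : σ t < 1 := by
    rw [← unitInterval.symm_zero, unitInterval.symm_lt_symm]
    exact unitInterval.pos_iff_ne_zero.2 h₀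
  refine ⟨⟨⟨d, t⟩, h₁', rfl⟩, ⟨⟨d.symm, σ t⟩, h₀', M.arc_symm_symm d t⟩, fun h => ?_, ?_⟩
  · exact d.symm_ne (congrArg (fun q => q.1.1) h).symm
  · refine eq_univ_of_forall ?_
    rintro ⟨⟨e, s⟩, hs, h⟩
    rcases direction_cases h₁' hs h.symm with ⟨rfl, rfl⟩ | ⟨-, -, h, -⟩ | ⟨rfl, rfl, -⟩
    · exact Or.inl rfl
    · exact (h₀ h).elim
    · exact Or.inr rfl

omit [DecidableEq V] [DecidableRel G.Adj] in
theorem eq_pt_or_mengerOrder_eq_two [T2Space X] (hG : G.IsTree) (M : ArcRealization G X) (p : X) :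
    (∃ v, M.pt v = p) ∨ mengerOrder p = 2 := by
  obtain ⟨d, t, rfl⟩ := M.exists_arc_eq p
  by_cases h₀ : t = 0
  · subst h₀
    exact Or.inl ⟨_, (M.arc_zero d).symm⟩
  by_cases h₁ : t = 1
  · subst h₁
    exact Or.inl ⟨_, (M.arc_one d).symm⟩
  rw [mengerOrder_eq (M := M) hG, mk_direction_arc d h₀ h₁]
  exact Or.inr rfl

theorem endpointSet_eq [T2Space X] (hG : G.IsTree) (M : ArcRealization G X) :
    endpointSet X = M.pt '' {v | G.degree v = 1} := by
  ext p
  constructor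
  · intro (hp : mengerOrder p = 1)
    rcases eq_pt_or_mengerOrder_eq_two hG M p with ⟨v, rfl⟩ | h
    · rw [mengerOrder_eq (M := M) hG, mk_direction_pt] at hp
      exact ⟨v, by exact_mod_cast hp, rfl⟩
    · rw [h] at hp
      norm_num at hp
  · rintro ⟨v, hv, rfl⟩
    change mengerOrder _ = 1
    rw [mengerOrder_eq (M := M) hG, mk_direction_pt, show G.degree v = 1 from hv, Nat.cast_one]

theorem ramificationSet_eq [T2Space X] (hG : G.IsTree) (M : ArcRealization G X) :
    ramificationSet X = M.pt '' {v | 3 ≤ G.degree v} := by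
  ext p
  constructor
  · intro (hp : 3 ≤ mengerOrder p)
    rcases eq_pt_or_mengerOrder_eq_two hG M p with ⟨v, rfl⟩ | h
    · rw [mengerOrder_eq (M := M) hG, mk_direction_pt] at hp
      exact ⟨v, by exact_mod_cast hp, rfl⟩
    · rw [h] at hp
      exact absurd (by exact_mod_cast hp : (3 : ℕ) ≤ 2) (by norm_num)
  · rintro ⟨v, hv, rfl⟩
    change 3 ≤ mengerOrder _
    rw [mengerOrder_eq (M := M) hG, mk_direction_pt]
    exact_mod_cast hv

end

end ArcRealization

/-! ### Counting leaves and darts in a tree. -/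

namespace SimpleGraph

variable {V : Type*} [Fintype V] [DecidableEq V] {G : SimpleGraph V} [DecidableRel G.Adj]

theorem card_dart_degree_snd_eq_one :
    Fintype.card {d : G.Dart // G.degree d.snd = 1} = Fintype.card {v // G.degree v = 1} := by
  have h : Fintype.card {d : G.Dart // G.degree d.snd = 1} =
      Fintype.card {d : G.Dart // G.degree d.fst = 1} :=
    Fintype.card_congr ((Equiv.ofBijective _ Dart.symm_involutive.bijective).subtypeEquiv
      fun d => Iff.rfl)
  rw [h, Fintype.card_subtype, Fintype.card_subtype, Finset.card_eq_sum_card_fiberwise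
    (f := fun d : G.Dart => d.fst) (t := Finset.univ.filter fun v => G.degree v = 1)]
  · rw [Finset.card_eq_sum_ones]
    refine Finset.sum_congr rfl fun v hv => ?_
    have hv' := (Finset.mem_filter.1 hv).2
    rw [Finset.filter_filter]
    refine Eq.trans ?_ ((G.dart_fst_fiber_card_eq_degree v).trans hv')
    congr 1
    ext d
    simp only [Finset.mem_filter, Finset.mem_univ, true_and, and_iff_right_iff_imp]
    rintro rfl
    exact hv'
  · intro d hd
    simpa using hd

omit [DecidableEq V] in
theorem IsTree.card_dart_add_two (hG : G.IsTree) : Fintype.card G.Dart + 2 = 2 * Fintype.card V := by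
  rw [dart_card_eq_twice_card_edges, ← hG.card_edgeFinset]
  ring

theorem card_eq_of_degree (h₀ : ∀ v, G.degree v ≠ 0) (h₂ : ∀ v, G.degree v ≠ 2) :
    Fintype.card V = Fintype.card {v // G.degree v = 1} + Fintype.card {v // 3 ≤ G.degree v} := by
  rw [Fintype.card_subtype, Fintype.card_subtype, ← Finset.card_union_of_disjoint, ← Finset.card_univ]
  · congr 1
    ext v
    have := h₀ v
    have := h₂ v
    simp only [Finset.mem_univ, Finset.mem_union, Finset.mem_filter, true_and, true_iff]
    omega
  · rw [Finset.disjoint_filter]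
    intro v _ h
    omega

theorem IsTree.card_leaves_ge (hG : G.IsTree) (h₀ : ∀ v, G.degree v ≠ 0)
    (h₂ : ∀ v, G.degree v ≠ 2) :
    Fintype.card {v // 3 ≤ G.degree v} + 2 ≤ Fintype.card {v // G.degree v = 1} := by
  have h₁ := hG.card_dart_add_two
  have h₃ := card_eq_of_degree h₀ h₂
  -- Every degree is at least 1, and at least 3 at a ramification vertex. With `m` such vertices and
  -- `n` leaves this gives `(n + m) + 2m ≤ 2(n + m) - 2`.
  have h₄ : ∑ v, (1 + 2 * if 3 ≤ G.degree v then 1 else 0) ≤ ∑ v, G.degree v := by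
    refine Finset.sum_le_sum fun v _ => ?_
    have := h₀ v
    split_ifs <;> omega
  rw [← dart_card_eq_sum_degrees, Finset.sum_add_distrib, ← Finset.mul_sum, ← Finset.card_filter,
    ← Fintype.card_subtype, Finset.sum_const, Finset.card_univ, smul_eq_mul, mul_one] at h₄
  omega

end SimpleGraph

/-! ### The structure of `NCStar X` for a realization without vertices of degree 2. -/

namespace ArcRealization

universe u

variable {V X : Type u} [Fintype V] [DecidableEq V] {G : SimpleGraph V} [DecidableRel G.Adj]
  [TopologicalSpace X]

theorem eq_of_fst_eq_of_degree_eq_one {d e : G.Dart} (hd : G.degree d.fst = 1)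
    (h : e.fst = d.fst) : e = d := by
  rw [← G.dart_fst_fiber_card_eq_degree] at hd
  exact Finset.card_le_one.1 hd.le e (by simpa using h) d (by simp)

theorem back_one_eq_univ_of_degree (hG : G.IsTree) (M : ArcRealization G X) {d : G.Dart}
    (hd : G.degree d.snd = 1) : M.back d 1 = univ :=
  back_one_eq_univ hG fun _ he => eq_of_fst_eq_of_degree_eq_one (d := d.symm) hd he

variable [T2Space X]

theorem backCompacts_one_notMem_NCStar (hG : G.IsTree) (M : ArcRealization G X) {d : G.Dart}
    (hd : 3 ≤ G.degree d.snd) : M.backCompacts d 1 ∉ NCStar X := by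
  intro h
  have hcard : 1 < ((Finset.univ.filter fun e : G.Dart => e.fst = d.snd).erase d.symm).card := by
    rw [Finset.card_erase_of_mem (by simp), G.dart_fst_fiber_card_eq_degree]
    omega
  obtain ⟨e, f, he, hf, hef⟩ := Finset.one_lt_card_iff.1 hcard
  simp only [Finset.mem_erase, Finset.mem_filter, Finset.mem_univ, true_and] at he hf
  exact not_isPreconnected_compl_back_one hG he.2 hf.2 he.1 hf.1 hef h.2

/-- If all vertices are leaves, `back d 1` and `back d.symm 1` are both the whole space, which
leaves no point off the arc of `d`. -/
theorem exists_three_le_degree [CompactSpace X] (hG : G.IsTree) (M : ArcRealization G X)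
    (h₂ : ∀ v, G.degree v ≠ 2) (d : G.Dart) (hX : IsEmpty (X ≃ₜ I)) : ∃ v, 3 ≤ G.degree v := by
  by_contra! h
  have h₁ : ∀ e : G.Dart, M.back e 1 = univ := by
    intro e
    refine back_one_eq_univ_of_degree hG M ?_
    have := h e.snd
    have := h₂ e.snd
    have := (G.degree_pos_iff_exists_adj e.snd).2 ⟨_, e.symm.adj⟩
    omega
  have hs : Function.Surjective (M.arc d) := by
    intro x
    have hx : x ∈ M.back d 1 := h₁ d ▸ mem_univ x
    by_cases hx₀ : x ∈ M.back d 0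
    · refine ⟨0, (eq_arc_of_mem_back hG.isAcyclic hx₀ ?_).symm⟩
      rw [unitInterval.symm_zero, h₁]
      exact mem_univ x
    · obtain ⟨r, -, -, hr⟩ := arc_eq_of_mem_back hx hx₀
      exact ⟨r, hr⟩
  exact hX.elim (IsHomeomorph.homeomorph _ (isHomeomorph_iff_continuous_isClosedMap_bijective.2
    ⟨M.continuous_arc d, (M.continuous_arc d).isClosedMap, M.arc_injective d, hs⟩)).symm

theorem nonempty_homeomorph_NCStar [PreconnectedSpace X] (hG : G.IsTree) (M : ArcRealization G X)
    (h₂ : ∀ v, G.degree v ≠ 2) {n N : ℕ} (hn : 0 < n)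
    (hn' : Fintype.card {d : G.Dart // G.degree d.snd = 1} = n)
    (hN : Fintype.card {d : G.Dart // ¬ G.degree d.snd = 1} = N) :
    Nonempty (NCStar X ≃ₜ TopologicalCone (Fin n) ⊕ (Σ _ : Fin N, Ico (0 : ℝ) 1)) := by
  let a := (Fintype.equivFinOfCardEq hn').symm
  let b := (Fintype.equivFinOfCardEq hN).symm
  let c : Fin n ⊕ Fin N ≃ G.Dart := (a.sumCongr b).trans (Equiv.sumCompl _)
  have ha : ∀ i, M.back (a i).1 1 = univ := fun i => back_one_eq_univ_of_degree hG M (a i).2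
  have hb : ∀ j, M.backCompacts (b j).1 1 ∉ NCStar X := by
    refine fun j => backCompacts_one_notMem_NCStar hG M ?_
    have := h₂ (b j).1.snd
    have := (b j).2
    have := (G.degree_pos_iff_exists_adj (b j).1.snd).2 ⟨_, (b j).1.symm.adj⟩
    omega
  have huniv : ∀ {d : G.Dart} {t : I} {i : Fin n},
      M.backCompacts d t = M.backCompacts (a i).1 1 ↔ M.back d t = univ := by
    intro d t i
    rw [backCompacts_inj, ha]
  refine nonempty_homeomorph_cone_sum_Ico hn (F := fun k => M.backCompacts (c k))
    (y₀ := M.backCompacts (a ⟨0, hn⟩).1 1) (fun k => continuous_backCompacts _)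
    (fun i t => ?_) (fun i => huniv.2 (ha i)) (fun j t => ⟨fun h => ?_, fun h => ?_⟩)
    (fun k l s t hs ht h => ?_) (fun k t ht h => back_ne_univ hG _ ht (huniv.1 h)) fun A hA => ?_
  · rcases eq_or_ne t 1 with rfl | ht
    · refine ⟨⟨⟨_, arc_mem_back _ le_rfl⟩, isPreconnected_back _ _⟩, ?_⟩
      change IsPreconnected (M.back (a i).1 1)ᶜ
      rw [ha, compl_univ]
      exact isPreconnected_empty
    · exact backCompacts_mem_NCStar hG _ (unitInterval.lt_one_iff_ne_one.2 ht)
  · refine unitInterval.lt_one_iff_ne_one.2 ?_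
    rintro rfl
    exact hb j h
  · exact backCompacts_mem_NCStar hG _ h
  · obtain ⟨h₁, h₂⟩ := back_injective hG hs ht (backCompacts_inj.1 h)
    exact ⟨c.injective h₁, h₂⟩
  · by_cases hA' : (A : Set X) = univ
    · refine Or.inl (SetLike.coe_injective ?_)
      rw [hA', coe_backCompacts, ha]
    · obtain ⟨d, t, ht, h⟩ := exists_eq_back (M := M) hG A.isCompact.isClosed hA.1 hA.2 hA'
      refine Or.inr ⟨c.symm d, t, ht, SetLike.coe_injective ?_⟩
      rw [h, c.apply_symm_apply, coe_backCompacts]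

theorem NCStar_structure [CompactSpace X] [PreconnectedSpace X] (hG : G.IsTree)
    (M : ArcRealization G X) (h₀ : ∀ v, G.degree v ≠ 0) (h₂ : ∀ v, G.degree v ≠ 2) (d : G.Dart)
    (hX : IsEmpty (X ≃ₜ I)) : (ramificationSet X).Finite ∧ (endpointSet X).Finite ∧
      ∀ m n : ℕ, (ramificationSet X).ncard = m → (endpointSet X).ncard = n →
        ∃ (K : Type) (_ : TopologicalSpace K), IsSimpleNOd n K ∧
          Nonempty (NCStar X ≃ₜ K ⊕ (Σ _ : Fin (n + 2 * m - 2), Ico (0 : ℝ) 1)) := by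
  rw [ramificationSet_eq hG M, endpointSet_eq hG M]
  refine ⟨(toFinite _).image _, (toFinite _).image _, ?_⟩
  rintro m n rfl rfl
  rw [ncard_image_of_injective _ M.pt_injective, ncard_image_of_injective _ M.pt_injective,
    ← Nat.card_coe_set_eq, ← Nat.card_coe_set_eq, Nat.card_eq_fintype_card, Nat.card_eq_fintype_card]
  obtain ⟨v, hv⟩ := exists_three_le_degree hG M h₂ d hX
  have hm : 0 < Fintype.card {v // 3 ≤ G.degree v} := Fintype.card_pos_iff.2 ⟨⟨v, hv⟩⟩
  have hn := hG.card_leaves_ge h₀ h₂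
  have hV := SimpleGraph.card_eq_of_degree h₀ h₂
  have hd := hG.card_dart_add_two
  have hl := SimpleGraph.card_dart_degree_snd_eq_one (G := G)
  have hc := Fintype.card_subtype_compl fun d : G.Dart => G.degree d.snd = 1
  refine ⟨_, inferInstance, ⟨?_, ⟨Homeomorph.refl _⟩⟩,
    nonempty_homeomorph_NCStar hG M h₂ ?_ hl ?_⟩
  · change 3 ≤ Fintype.card {v // G.degree v = 1}
    omega
  · change 0 < Fintype.card {v // G.degree v = 1}
    omega
  -- The count is `2(n + m) - 2 - n`; the truncated subtraction is harmless because `n ≥ 3`.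
  · rw [hc, hl]
    change _ = Fintype.card {v // G.degree v = 1} + 2 * Fintype.card {v // 3 ≤ G.degree v} - 2
    omega

end ArcRealization

/-! ### Concatenation of arcs and simple closed curves. -/

section

variable {X : Type*} [TopologicalSpace X]

/-- Allowing the second coincidence in `h` lets the lemma serve both for arcs and for loops, whose
two ends agree. -/
theorem Path.trans_eq_trans {x y z : X} {p : Path x y} {q : Path y z}
    (hp : Function.Injective p) (hq : Function.Injective q)
    (h : ∀ s t, p s = q t → (s = 1 ∧ t = 0) ∨ (s = 0 ∧ t = 1)) {s t : I}
    (hst : p.trans q s = p.trans q t) : s = t ∨ (s = 0 ∧ t = 1) ∨ (s = 1 ∧ t = 0) := by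
  have key : ∀ s t : I, (s : ℝ) ≤ 1 / 2 → ¬ (t : ℝ) ≤ 1 / 2 → p.trans q s = p.trans q t →
      s = 0 ∧ t = 1 := by
    intro s t hs ht hst
    rw [Path.trans_apply, Path.trans_apply, dif_pos hs, dif_neg ht] at hst
    rcases h _ _ hst with ⟨-, h₂⟩ | ⟨h₁, h₂⟩
    · have := congrArg Subtype.val h₂
      simp only [Set.Icc.coe_zero] at this
      exact (ht (by linarith)).elim
    · have h₁ := congrArg Subtype.val h₁
      have h₂ := congrArg Subtype.val h₂
      simp only [Set.Icc.coe_zero, Set.Icc.coe_one] at h₁ h₂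
      constructor <;> apply Subtype.ext <;> simp only [Set.Icc.coe_zero, Set.Icc.coe_one] <;> linarith
  by_cases hs : (s : ℝ) ≤ 1 / 2 <;> by_cases ht : (t : ℝ) ≤ 1 / 2
  · rw [Path.trans_apply, Path.trans_apply, dif_pos hs, dif_pos ht] at hst
    have := congrArg Subtype.val (hp hst)
    exact Or.inl (Subtype.ext (by simpa using this))
  · exact Or.inr (Or.inl (key s t hs ht hst))
  · exact Or.inr (Or.inr (key t s ht hs hst.symm).symm)
  · rw [Path.trans_apply, Path.trans_apply, dif_neg hs, dif_neg ht] at hst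
    have := congrArg Subtype.val (hq hst)
    exact Or.inl (Subtype.ext (by simpa using this))

theorem exists_concat_arcs {p q : I → X} (hp : Continuous p) (hq : Continuous q)
    (hp' : Function.Injective p) (hq' : Function.Injective q) (hpq : p 1 = q 0)
    (h : ∀ s t, p s = q t → s = 1) : ∃ r : I → X, Continuous r ∧ Function.Injective r ∧
      r 0 = p 0 ∧ r 1 = q 1 ∧ range r = range p ∪ range q := by
  let P : Path (p 0) (p 1) := ⟨⟨p, hp⟩, rfl, rfl⟩
  let Q : Path (p 1) (q 1) := ⟨⟨q, hq⟩, hpq.symm, rfl⟩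
  have h01 : p 0 ≠ q 1 := fun h' => zero_ne_one (h _ _ h')
  have hP : (P : I → X) = p := rfl
  have hQ : (Q : I → X) = q := rfl
  have hPQ : ∀ s t, P s = Q t → (s = 1 ∧ t = 0) ∨ (s = 0 ∧ t = 1) := by
    intro s t hst
    obtain rfl := h s t hst
    exact Or.inl ⟨rfl, hq' (hst.symm.trans hpq)⟩
  refine ⟨P.trans Q, (P.trans Q).continuous, fun s t hst => ?_, (P.trans Q).source,
    (P.trans Q).target, by rw [Path.trans_range, hP, hQ]⟩
  rcases Path.trans_eq_trans hp' hq' hPQ hst with h | ⟨rfl, rfl⟩ | ⟨rfl, rfl⟩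
  · exact h
  · rw [Path.source, Path.target] at hst
    exact (h01 hst).elim
  · rw [Path.source, Path.target] at hst
    exact (h01 hst.symm).elim

/-- Two arcs with the same end points that meet only there form a simple closed curve. -/
theorem exists_isSimpleClosedCurve [T2Space X] {p q : I → X} (hp : Continuous p)
    (hq : Continuous q) (hp' : Function.Injective p) (hq' : Function.Injective q)
    (h₀ : p 0 = q 0) (h₁ : p 1 = q 1) (h : ∀ s t, p s = q t → s = 0 ∨ s = 1) :
    ∃ S : Set X, IsSimpleClosedCurve S := by
  let P : Path (p 0) (p 1) := ⟨⟨p, hp⟩, rfl, rfl⟩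
  let Q : Path (p 0) (p 1) := ⟨⟨q, hq⟩, h₀.symm, h₁.symm⟩
  have hPQ : ∀ s t, P s = Q.symm t → (s = 1 ∧ t = 0) ∨ (s = 0 ∧ t = 1) := by
    intro s t hst
    have hst : p s = q (σ t) := hst
    rcases h _ _ hst with rfl | rfl
    · have := hq' (h₀.symm.trans hst)
      refine Or.inr ⟨rfl, ?_⟩
      rw [← unitInterval.symm_symm t, ← this, unitInterval.symm_zero]
    · have := hq' (h₁.symm.trans hst)
      refine Or.inl ⟨rfl, ?_⟩
      rw [← unitInterval.symm_symm t, ← this, unitInterval.symm_one]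
  have hQs : Function.Injective Q.symm := fun s t hst => by
    have hst : q (σ s) = q (σ t) := hst
    simpa using hq' hst
  let L := P.trans Q.symm
  have : Fact ((0 : ℝ) < 1) := ⟨one_pos⟩
  -- The loop descends to the circle `ℝ/ℤ` and is injective there, its only coincidence being that
  -- of the parameters `0` and `1`.
  have hc : Continuous (AddCircle.liftIco 1 0 L.extend) :=
    AddCircle.liftIco_zero_continuous (by rw [Path.extend_zero, Path.extend_one])
      L.continuous_extend.continuousOn
  have hi : Function.Injective (AddCircle.liftIco 1 0 L.extend) := by
    intro x y hxy
    obtain ⟨s, hs, rfl⟩ := AddCircle.coe_image_Ico_eq (1 : ℝ) 0 ▸ mem_univ x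
    obtain ⟨t, ht, rfl⟩ := AddCircle.coe_image_Ico_eq (1 : ℝ) 0 ▸ mem_univ y
    rw [zero_add] at hs ht
    rw [AddCircle.liftIco_zero_coe_apply hs, AddCircle.liftIco_zero_coe_apply ht,
      Path.extend_apply _ (Ico_subset_Icc_self hs), Path.extend_apply _ (Ico_subset_Icc_self ht)]
      at hxy
    rcases Path.trans_eq_trans hp' hQs hPQ hxy with h | ⟨-, h⟩ | ⟨h, -⟩
    · rw [show s = t from congrArg Subtype.val h]
    · exact (ht.2.ne (congrArg Subtype.val h)).elim
    · exact (hs.2.ne (congrArg Subtype.val h)).elim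
  exact ⟨_, ⟨(hc.isClosedEmbedding hi).isEmbedding.toHomeomorph.symm.trans
    (AddCircle.homeomorphCircle one_ne_zero)⟩⟩

end

/-! ### Connectedness and acyclicity of the underlying graph. -/

namespace ArcRealization

variable {V : Type*} {G : SimpleGraph V} {X : Type*} [TopologicalSpace X]

theorem reachable_of_arc_eq (M : ArcRealization G X) {d e : G.Dart} {s t : I}
    (h : M.arc d s = M.arc e t) : G.Reachable d.fst e.fst := by
  have key : ∀ v, M.arc d s = M.pt v → G.Reachable d.fst e.fst := by
    intro v hv
    have h₁ : G.Reachable d.fst v := by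
      rcases M.pt_eq_arc hv.symm with ⟨rfl, -⟩ | ⟨rfl, -⟩
      exacts [.refl _, d.adj.reachable]
    have h₂ : G.Reachable v e.fst := by
      rcases M.pt_eq_arc (hv.symm.trans h) with ⟨rfl, -⟩ | ⟨rfl, -⟩
      exacts [.refl _, e.symm.adj.reachable]
    exact h₁.trans h₂
  by_cases h₀ : s = 0
  · exact key _ (h₀ ▸ M.arc_zero d)
  by_cases h₁ : s = 1
  · exact key _ (h₁ ▸ M.arc_one d)
  rcases M.eq_or_eq_symm d e s t h₀ h₁ h with rfl | rfl
  exacts [.refl _, d.adj.reachable]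

/-- The arcs reachable from `u` and the remaining arcs have disjoint unions, both closed by
finiteness, so the first union is clopen and nonempty. -/
theorem preconnected [Finite V] [T2Space X] [PreconnectedSpace X] (M : ArcRealization G X)
    (hV : ∀ v, ∃ d : G.Dart, d.fst = v) : G.Preconnected := by
  intro u v
  have := finite_dart (G := G)
  have hcl : ∀ S : Set G.Dart, IsClosed (⋃ d ∈ S, range (M.arc d)) := fun S =>
    S.toFinite.isClosed_biUnion fun d _ => (isCompact_range (M.continuous_arc d)).isClosed
  have hcompl : (⋃ d ∈ {d : G.Dart | G.Reachable u d.fst}, range (M.arc d))ᶜ =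
      ⋃ d ∈ {d : G.Dart | ¬ G.Reachable u d.fst}, range (M.arc d) := by
    ext x
    simp only [mem_compl_iff, mem_iUnion, mem_ofPred_eq, mem_range, exists_prop]
    constructor
    · intro h
      obtain ⟨d, t, rfl⟩ := M.exists_arc_eq x
      exact ⟨d, fun hd => h ⟨d, hd, t, rfl⟩, t, rfl⟩
    · rintro ⟨d, hd, t, rfl⟩ ⟨e, he, s, hs⟩
      exact hd (he.trans (M.reachable_of_arc_eq hs))
  have hclopen : IsClopen (⋃ d ∈ {d : G.Dart | G.Reachable u d.fst}, range (M.arc d)) :=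
    ⟨hcl _, isClosed_compl_iff.1 (hcompl ▸ hcl _)⟩
  obtain ⟨d, rfl⟩ := hV u
  obtain ⟨e, rfl⟩ := hV v
  have h := hclopen.eq_univ ⟨M.arc d 0, mem_iUnion₂.2 ⟨d, .refl _, 0, rfl⟩⟩
  obtain ⟨f, hf, s, hs⟩ := mem_iUnion₂.1 (h ▸ mem_univ (M.arc e 0))
  exact SimpleGraph.Reachable.trans hf (M.reachable_of_arc_eq hs)

theorem exists_arc_of_isPath (M : ArcRealization G X) {u v : V} (p : G.Walk u v) (hp : p.IsPath)
    (huv : u ≠ v) : ∃ γ : I → X, Continuous γ ∧ Function.Injective γ ∧ γ 0 = M.pt u ∧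
      γ 1 = M.pt v ∧ ∀ t, ∃ d ∈ p.darts, ∃ s, M.arc d s = γ t := by
  induction p with
  | nil => exact (huv rfl).elim
  | @cons u w v h q ih =>
    rw [SimpleGraph.Walk.cons_isPath_iff] at hp
    let e : G.Dart := ⟨(u, w), h⟩
    by_cases hwv : w = v
    · subst hwv
      exact ⟨M.arc e, M.continuous_arc e, M.arc_injective e, M.arc_zero e, M.arc_one e,
        fun t => ⟨e, by simp [e], t, rfl⟩⟩
    obtain ⟨γ, hγ, hγ', h₀, h₁, hq⟩ := ih hp.1 hwv
    obtain ⟨r, hr, hr', hr₀, hr₁, hr₂⟩ := exists_concat_arcs (M.continuous_arc e) hγ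
      (M.arc_injective e) hγ' ((M.arc_one e).trans h₀.symm) (by
        intro s t hst
        obtain ⟨d, hd, r, hdr⟩ := hq t
        have h₁ : d.fst ≠ u := fun h => hp.2 (h ▸ q.dart_fst_mem_support_of_mem_darts hd)
        have h₂ : d.snd ≠ u := fun h => hp.2 (h ▸ q.dart_snd_mem_support_of_mem_darts hd)
        rcases eq_zero_or_one_of_arc_eq (e := d) (by rintro rfl; exact h₁ rfl)
          (by rintro rfl; exact h₂ rfl) (hst.trans hdr.symm) with rfl | rfl
        · rw [← hdr, M.arc_zero] at hst
          rcases M.pt_eq_arc hst with ⟨h, -⟩ | ⟨h, -⟩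
          exacts [(h₁ h.symm).elim, (h₂ h.symm).elim]
        · rfl)
    refine ⟨r, hr, hr', hr₀.trans (M.arc_zero e), hr₁.trans h₁, fun t => ?_⟩
    rcases hr₂ ▸ mem_range_self t with ⟨s, hs⟩ | ⟨s, hs⟩
    · exact ⟨e, by simp [e], s, hs⟩
    · obtain ⟨d, hd, a, ha⟩ := hq s
      exact ⟨d, by simp [hd], a, ha.trans hs⟩

/-- A cycle is an edge together with a path joining its ends; the arc of the edge and the arc along
the path meet only at their ends and form a simple closed curve. -/
theorem isAcyclic [T2Space X] (M : ArcRealization G X)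
    (hX : ∀ S : Set X, ¬ IsSimpleClosedCurve S) : G.IsAcyclic := by
  intro u c hc
  cases c with
  | nil => exact hc.ne_nil rfl
  | @cons _ w _ h p =>
    rw [SimpleGraph.Walk.cons_isCycle_iff] at hc
    let e : G.Dart := ⟨(u, w), h⟩
    obtain ⟨γ, hγ, hγ', h₀, h₁, hp⟩ := M.exists_arc_of_isPath p hc.1 h.ne'
    obtain ⟨S, hS⟩ := exists_isSimpleClosedCurve (M.continuous_arc e.symm) hγ
      (M.arc_injective e.symm) hγ' ((M.arc_zero e.symm).trans h₀.symm)
      ((M.arc_one e.symm).trans h₁.symm) (by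
        intro s t hst
        obtain ⟨d, hd, r, hdr⟩ := hp t
        have hde : d.edge ≠ e.edge := fun h => hc.2 (by
          have : d.edge ∈ p.edges := List.mem_map_of_mem hd
          rw [h] at this
          exact this)
        refine eq_zero_or_one_of_arc_eq (e := d) ?_ ?_ (hst.trans hdr.symm)
        · rintro rfl
          exact hde e.edge_symm
        · rw [SimpleGraph.Dart.symm_symm]
          rintro rfl
          exact hde rfl)
    exact hX S hS

end ArcRealization

/-! ### Families of arcs and their graphs. -/

/-- A parametrized family of arcs that covers a space and whose members meet only in end points. -/
structure ArcFamily (ι : Type*) (X : Type*) [TopologicalSpace X] where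
  arc : ι → I → X
  continuous_arc : ∀ i, Continuous (arc i)
  arc_injective : ∀ i, Function.Injective (arc i)
  exists_arc_eq : ∀ x, ∃ i t, arc i t = x
  eq_zero_or_one : ∀ i j s t, i ≠ j → arc i s = arc j t → (s = 0 ∨ s = 1) ∧ (t = 0 ∨ t = 1)

namespace ArcFamily

universe u

variable {ι κ : Type*} {X : Type u} [TopologicalSpace X]

def reindex (F : ArcFamily ι X) (e : κ ≃ ι) : ArcFamily κ X where
  arc k := F.arc (e k)
  continuous_arc k := F.continuous_arc _
  arc_injective k := F.arc_injective _
  exists_arc_eq x := by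
    obtain ⟨i, t, h⟩ := F.exists_arc_eq x
    exact ⟨e.symm i, t, by rwa [e.apply_symm_apply]⟩
  eq_zero_or_one i j s t h := F.eq_zero_or_one _ _ s t (e.injective.ne h)

/-- The arc with index `i`, run through backwards if `b` is `true`. -/
def oarc (F : ArcFamily ι X) (i : ι) (b : Bool) (t : I) : X := F.arc i (if b then σ t else t)

variable {F : ArcFamily ι X}

theorem continuous_oarc (i : ι) (b : Bool) : Continuous (F.oarc i b) := by
  refine (F.continuous_arc i).comp ?_
  cases b
  exacts [continuous_id, unitInterval.continuous_symm]

theorem oarc_injective (i : ι) (b : Bool) : Function.Injective (F.oarc i b) := by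
  intro s t h
  have := F.arc_injective i h
  cases b <;> simpa using this

theorem oarc_not (i : ι) (b : Bool) (t : I) : F.oarc i (!b) t = F.oarc i b (σ t) := by
  cases b <;> simp [oarc]

theorem oarc_not_zero (i : ι) (b : Bool) : F.oarc i (!b) 0 = F.oarc i b 1 := by
  rw [oarc_not, unitInterval.symm_zero]

theorem oarc_not_one (i : ι) (b : Bool) : F.oarc i (!b) 1 = F.oarc i b 0 := by
  rw [oarc_not, unitInterval.symm_one]

theorem oarc_zero_ne_one (i : ι) (b : Bool) : F.oarc i b 0 ≠ F.oarc i b 1 :=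
  (oarc_injective i b).ne zero_ne_one

theorem exists_oarc_eq (F : ArcFamily ι X) (x : X) : ∃ i t, F.oarc i false t = x :=
  F.exists_arc_eq x

theorem oarc_eq_zero_or_one {i j : ι} (hij : i ≠ j) {b c : Bool} {s t : I}
    (h : F.oarc i b s = F.oarc j c t) : (s = 0 ∨ s = 1) ∧ (t = 0 ∨ t = 1) := by
  obtain ⟨h₁, h₂⟩ := F.eq_zero_or_one _ _ _ _ hij h
  constructor
  · cases b
    · exact h₁
    · simpa [or_comm] using h₁
  · cases c
    · exact h₂
    · simpa [or_comm] using h₂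

/-- This rules out multiple edges, so that a simple graph records the family faithfully. -/
theorem eq_of_zero_eq_of_one_eq [T2Space X] (hX : ∀ S : Set X, ¬ IsSimpleClosedCurve S) {i j : ι}
    {b c : Bool} (h₀ : F.oarc i b 0 = F.oarc j c 0) (h₁ : F.oarc i b 1 = F.oarc j c 1) :
    i = j ∧ b = c := by
  have hij : i = j := by
    by_contra hij
    obtain ⟨S, hS⟩ := exists_isSimpleClosedCurve (continuous_oarc i b) (continuous_oarc j c)
      (oarc_injective i b) (oarc_injective j c) h₀ h₁ fun s t h => (oarc_eq_zero_or_one hij h).1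
    exact hX S hS
  subst hij
  refine ⟨rfl, ?_⟩
  by_contra hbc
  obtain rfl : c = !b := Bool.eq_not_of_ne (Ne.symm hbc)
  rw [oarc_not_zero] at h₀
  exact oarc_zero_ne_one i b h₀

/-- Two arcs that form a neighborhood of a common end point can be merged into one arc. -/
theorem nonempty_merge {i j : ι} (hij : i ≠ j) {b c : Bool}
    (h₀ : F.oarc i b 0 = F.oarc j c 0) (h₁ : F.oarc i b 1 ≠ F.oarc j c 1)
    (h : ∀ l a, F.oarc l a 0 = F.oarc i b 0 → l = i ∨ l = j) :
    Nonempty (ArcFamily {l // l ≠ j} X) := by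
  classical
  obtain ⟨r, hr, hr', hr₀, hr₁, hrr⟩ := exists_concat_arcs (continuous_oarc (F := F) i (!b))
    (continuous_oarc j c) (oarc_injective i _) (oarc_injective j c)
    ((oarc_not_one i b).trans h₀) (by
      intro s t hst
      obtain ⟨rfl | rfl, ht⟩ := oarc_eq_zero_or_one hij hst
      · rw [oarc_not_zero] at hst
        rcases ht with rfl | rfl
        · exact (oarc_zero_ne_one i b (h₀.trans hst.symm)).elim
        · exact (h₁ hst).elim
      · rfl)
  -- By `h` no other arc touches the merging point, so the others meet `r` only at its ends.
  have hlr : ∀ l s t, l ≠ i → l ≠ j → F.arc l s = r t → (s = 0 ∨ s = 1) ∧ (t = 0 ∨ t = 1) := by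
    intro l s t hli hlj hst
    have hv : F.arc l s ≠ F.oarc i b 0 := by
      intro hs
      obtain ⟨rfl | rfl, -⟩ := oarc_eq_zero_or_one (F := F) (b := false) hli hs
      · exact (h l false hs).elim hli hlj
      · exact (h l true ((oarc_not_zero l false).trans hs)).elim hli hlj
    rcases hrr ▸ mem_range_self t with ⟨a, ha⟩ | ⟨a, ha⟩
    · obtain ⟨hs, rfl | rfl⟩ := oarc_eq_zero_or_one (F := F) (b := false) hli (hst.trans ha.symm)
      · exact ⟨hs, Or.inl (hr' (ha.symm.trans hr₀.symm))⟩
      · exact (hv (hst.trans (ha.symm.trans (oarc_not_one i b)))).elim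
    · obtain ⟨hs, rfl | rfl⟩ := oarc_eq_zero_or_one (F := F) (b := false) hlj (hst.trans ha.symm)
      · exact (hv (hst.trans (ha.symm.trans h₀.symm))).elim
      · exact ⟨hs, Or.inr (hr' (ha.symm.trans hr₁.symm))⟩
  refine ⟨⟨fun l => if l.1 = i then r else F.arc l, fun l => ?_, fun l => ?_, fun x => ?_,
    fun l k s t hlk hst => ?_⟩⟩
  · split_ifs
    exacts [hr, F.continuous_arc _]
  · split_ifs
    exacts [hr', F.arc_injective _]
  · have key : x ∈ range r → ∃ (l : {l // l ≠ j}) (t : I),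
        (if l.1 = i then r else F.arc l) t = x := by
      rintro ⟨t, rfl⟩
      exact ⟨⟨i, hij⟩, t, by rw [if_pos rfl]⟩
    have hsymm : ∀ i b, range (F.oarc i b) = range (F.arc i) := by
      intro i b
      cases b
      · rfl
      · exact unitInterval.symm_involutive.surjective.range_comp (F.arc i)
    obtain ⟨l, t, rfl⟩ := F.exists_arc_eq x
    by_cases hlj : l = j
    · subst hlj
      exact key (hrr ▸ Or.inr (hsymm l c ▸ mem_range_self t))
    by_cases hli : l = i
    · subst hli
      exact key (hrr ▸ Or.inl (hsymm l (!b) ▸ mem_range_self t))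
    · exact ⟨⟨l, hlj⟩, t, by rw [if_neg hli]⟩
  · have hlk' : l.1 ≠ k.1 := fun h => hlk (Subtype.ext h)
    split_ifs at hst with hl hk hk
    · exact (hlk' (hl.trans hk.symm)).elim
    · exact (hlr _ _ _ hk k.2 hst.symm).symm
    · exact hlr _ _ _ hl l.2 hst
    · exact F.eq_zero_or_one _ _ _ _ hlk' hst

/-- The end points of the arcs. -/
def Vertex (F : ArcFamily ι X) : Type u := {x : X // ∃ i b, F.oarc i b 0 = x}

/-- The graph formed by the arcs. -/
def graph (F : ArcFamily ι X) : SimpleGraph F.Vertex where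
  Adj u v := ∃ i b, F.oarc i b 0 = u.1 ∧ F.oarc i b 1 = v.1
  symm := ⟨by
    rintro u v ⟨i, b, hu, hv⟩
    exact ⟨i, !b, (oarc_not_zero i b).trans hv, (oarc_not_one i b).trans hu⟩⟩
  loopless := ⟨by
    rintro u ⟨i, b, hu, hv⟩
    exact oarc_zero_ne_one i b (hu.trans hv.symm)⟩

theorem exists_oarc_of_dart (d : F.graph.Dart) :
    ∃ q : ι × Bool, F.oarc q.1 q.2 0 = d.fst.1 ∧ F.oarc q.1 q.2 1 = d.snd.1 := by
  obtain ⟨i, b, h⟩ := d.adj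
  exact ⟨(i, b), h⟩

/-- The dart of the graph that belongs to an oriented arc. -/
def dart (F : ArcFamily ι X) (i : ι) (b : Bool) : F.graph.Dart :=
  ⟨(⟨_, i, b, rfl⟩, ⟨_, i, !b, oarc_not_zero i b⟩), i, b, rfl, rfl⟩

/-- The oriented arc that belongs to a dart of the graph. -/
noncomputable def index (d : F.graph.Dart) : ι × Bool := (exists_oarc_of_dart d).choose

theorem oarc_index_zero (d : F.graph.Dart) : F.oarc (index d).1 (index d).2 0 = d.fst.1 :=
  (exists_oarc_of_dart d).choose_spec.1

theorem oarc_index_one (d : F.graph.Dart) : F.oarc (index d).1 (index d).2 1 = d.snd.1 :=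
  (exists_oarc_of_dart d).choose_spec.2

theorem dart_index (d : F.graph.Dart) : F.dart (index d).1 (index d).2 = d :=
  SimpleGraph.Dart.ext _ _ (Prod.ext (Subtype.ext (oarc_index_zero d))
    (Subtype.ext (oarc_index_one d)))

theorem dart_symm (i : ι) (b : Bool) : (F.dart i b).symm = F.dart i (!b) :=
  SimpleGraph.Dart.ext _ _ (Prod.ext (Subtype.ext (oarc_not_zero i b).symm)
    (Subtype.ext (oarc_not_one i b).symm))

theorem index_dart [T2Space X] (hX : ∀ S : Set X, ¬ IsSimpleClosedCurve S) (i : ι) (b : Bool) : index (F.dart i b) = (i, b) := by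
  obtain ⟨h₁, h₂⟩ := eq_of_zero_eq_of_one_eq hX (oarc_index_zero (F.dart i b))
    (oarc_index_one (F.dart i b))
  exact Prod.ext h₁ h₂

theorem index_symm [T2Space X] (hX : ∀ S : Set X, ¬ IsSimpleClosedCurve S) (d : F.graph.Dart) :
    index d.symm = ((index d).1, !(index d).2) := by
  conv_lhs => rw [← dart_index d, dart_symm]
  exact index_dart hX _ _

/-- A space without simple closed curves that is covered by a family of arcs is a geometric
realization of the graph of the family. -/
noncomputable def realization [T2Space X] (F : ArcFamily ι X)
    (hX : ∀ S : Set X, ¬ IsSimpleClosedCurve S) : ArcRealization F.graph X where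
  pt v := v.1
  arc d := F.oarc (index d).1 (index d).2
  pt_injective := Subtype.val_injective
  continuous_arc d := continuous_oarc _ _
  arc_injective d := oarc_injective _ _
  arc_zero d := oarc_index_zero d
  arc_symm d t := by rw [index_symm hX, oarc_not]
  exists_arc_eq x := by
    obtain ⟨i, t, h⟩ := F.exists_oarc_eq x
    exact ⟨F.dart i false, t, by rwa [index_dart hX]⟩
  pt_ne_arc := by
    rintro ⟨_, i, b, rfl⟩ d t h₀ h₁ h
    by_cases hi : i = (index d).1
    · subst hi
      have := F.arc_injective _ h
      revert this
      have h₀' : 0 ≠ σ t := fun h => h₁ (by rw [← unitInterval.symm_symm t, ← h]; simp)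
      have h₁' : 1 ≠ σ t := fun h => h₀ (by rw [← unitInterval.symm_symm t, ← h]; simp)
      cases b <;> cases (index d).2 <;> simp [h₀', h₁', h₀.symm, h₁.symm]
    · exact (oarc_eq_zero_or_one hi h).2.elim h₀ h₁
  eq_or_eq_symm d e s t h₀ h₁ h := by
    have hi : (index d).1 = (index e).1 := by
      by_contra hi
      exact (oarc_eq_zero_or_one hi h).1.elim h₀ h₁
    rw [← dart_index d, ← dart_index e, dart_symm, hi]
    cases (index d).2 <;> cases (index e).2 <;> simp

theorem degree_ne_zero [Fintype F.Vertex] [DecidableRel F.graph.Adj] (v : F.Vertex) :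
    F.graph.degree v ≠ 0 := by
  obtain ⟨_, i, b, rfl⟩ := v
  exact ((F.graph.degree_pos_iff_exists_adj _).2 ⟨_, (F.dart i b).adj⟩).ne'

/-- The two neighbors are distinct, so the two arcs at `v` have different far ends, and the absence
of multiple edges excludes a third arc at `v`. -/
theorem nonempty_of_degree_eq_two [T2Space X] (hX : ∀ S : Set X, ¬ IsSimpleClosedCurve S)
    [Fintype F.Vertex] [DecidableRel F.graph.Adj] {v : F.Vertex} (hv : F.graph.degree v = 2) :
    ∃ j : ι, Nonempty (ArcFamily {l // l ≠ j} X) := by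
  classical
  obtain ⟨w, w', hne, hw⟩ := Finset.card_eq_two.1 hv
  have hadj : ∀ u, F.graph.Adj v u ↔ u = w ∨ u = w' := by
    intro u
    rw [← F.graph.mem_neighborFinset, hw]
    simp
  obtain ⟨i, b, hi₀, hi₁⟩ := (hadj w).2 (Or.inl rfl)
  obtain ⟨j, c, hj₀, hj₁⟩ := (hadj w').2 (Or.inr rfl)
  refine ⟨j, nonempty_merge (F := F) (i := i) (b := b) (c := c) ?_ (hi₀.trans hj₀.symm) ?_ ?_⟩
  · rintro rfl
    by_cases hbc : b = c
    · subst hbc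
      exact hne (Subtype.ext (hi₁.symm.trans hj₁))
    · obtain rfl : c = !b := Bool.eq_not_of_ne (Ne.symm hbc)
      rw [oarc_not_zero] at hj₀
      exact oarc_zero_ne_one i b (hi₀.trans hj₀.symm)
  · intro h
    exact hne (Subtype.ext (hi₁.symm.trans (h.trans hj₁)))
  · intro l a hl
    have hl₀ := hl.trans hi₀
    rcases (hadj ⟨F.oarc l a 1, l, !a, oarc_not_zero l a⟩).1 ⟨l, a, hl₀, rfl⟩ with h | h
    · exact Or.inl (eq_of_zero_eq_of_one_eq hX hl ((congrArg Subtype.val h).trans hi₁.symm)).1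
    · exact Or.inr (eq_of_zero_eq_of_one_eq hX (hl₀.trans hj₀.symm)
        ((congrArg Subtype.val h).trans hj₁.symm)).1

theorem finite_vertex [Finite ι] : Finite F.Vertex := by
  refine Finite.of_surjective (fun q : ι × Bool => (⟨_, q.1, q.2, rfl⟩ : F.Vertex)) ?_
  rintro ⟨_, i, b, rfl⟩
  exact ⟨(i, b), rfl⟩

end ArcFamily

/-! ### From topological trees to realizations, and the main theorem. -/

theorem IsFiniteGraph.exists_arcFamily {X : Type*} [MetricSpace X] (hX : IsFiniteGraph X) :
    ∃ k, Nonempty (ArcFamily (Fin k) X) := by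
  obtain ⟨k, A, a, b, h, hA, hAA⟩ := hX.exists_arcs
  choose f hf₀ hf₁ using h
  have key : ∀ i t, (f i t : X) = a i ∨ (f i t : X) = b i → t = 0 ∨ t = 1 := by
    intro i t h
    rw [← hf₀, ← hf₁] at h
    exact h.imp (fun h => (f i).injective (Subtype.ext h)) fun h => (f i).injective (Subtype.ext h)
  refine ⟨k, ⟨⟨fun i t => f i t, fun i => continuous_subtype_val.comp (f i).continuous,
    fun i => Subtype.val_injective.comp (f i).injective, fun x => ?_, fun i j s t hij hst => ?_⟩⟩⟩
  · obtain ⟨i, hi⟩ := mem_iUnion.1 (hA ▸ mem_univ x)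
    exact ⟨i, (f i).symm ⟨x, hi⟩, by rw [(f i).apply_symm_apply]⟩
  · have h := hAA i j hij ⟨(f i s).2, hst ▸ (f j t).2⟩
    exact ⟨key i s h.1, key j t (hst ▸ h.2)⟩

theorem mainTheorem5 {X : Type*} [MetricSpace X] (hX : IsTopologicalTree X)
    (hArc : IsEmpty (X ≃ₜ unitInterval)) :
    (ramificationSet X).Finite ∧ (endpointSet X).Finite ∧
      ∀ m n : ℕ, (ramificationSet X).ncard = m → (endpointSet X).ncard = n →
        ∃ (K : Type) (_ : TopologicalSpace K), IsSimpleNOd n K ∧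
          Nonempty (NCStar X ≃ₜ K ⊕ (Σ _ : Fin (n + 2 * m - 2), Ico (0 : ℝ) 1)) := by
  classical
  have hc := hX.isFiniteGraph.isContinuum.compact
  have hconn := hX.isFiniteGraph.isContinuum.connected
  have hscc := hX.no_simpleClosedCurve
  have hk := hX.isFiniteGraph.exists_arcFamily
  -- `F` has the least possible number of arcs; a vertex of degree 2 would allow a merge and hence a
  -- smaller family.
  obtain ⟨F⟩ := Nat.find_spec hk
  have := F.finite_vertex
  let _ := Fintype.ofFinite F.Vertex
  have h₂ : ∀ v, F.graph.degree v ≠ 2 := by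
    intro v hv
    obtain ⟨j, ⟨F'⟩⟩ := ArcFamily.nonempty_of_degree_eq_two hscc hv
    have hcard : Fintype.card {l // l ≠ j} = Nat.find hk - 1 := by
      simp
    exact Nat.find_min hk (Nat.sub_lt j.pos one_pos)
      ⟨F'.reindex (Fintype.equivFinOfCardEq hcard).symm⟩
  obtain ⟨i, -, -⟩ := F.exists_arc_eq (Classical.arbitrary X)
  let M := F.realization hscc
  have hG : F.graph.IsTree := by
    have hne : Nonempty F.Vertex := ⟨(F.dart i false).fst⟩
    refine ⟨⟨M.preconnected ?_⟩, M.isAcyclic hscc⟩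
    rintro ⟨_, i, b, rfl⟩
    exact ⟨F.dart i b, rfl⟩
  exact M.NCStar_structure hG F.degree_ne_zero h₂ (F.dart i false) hArc
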